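/- Let $\mathcal C\subset\mathbb P^2(\mathbb C)$ be a smooth complex cubic curve, that is, the zero locus of a homogeneous polynomial $\Phi(x,y,z)$ of degree $3$ such that the partial derivatives $\Phi_x,\Phi_y,\Phi_z$ do not all vanish at any point of $\mathcal C$. Let $\mathrm{Aut}(\mathbb P^2,\mathcal C)$ be the group of projective automorphisms of $\mathbb P^2(\mathbb C)$ (those induced by linear automorphisms of $\mathbb C^3$) which map $\mathcal C$ onto itself. A flex point of $\mathcal C$ is a point at which $\mathcal C$ and its tangent line have intersection multiplicity at least three. The invariant $J(\mathcal C)$ is the complex number $4a^3/(4a^3+27b^2)$, where $y^2=x^3+ax+b$ with $4a^3+27b^2\neq 0$ is any curve in standard normal form that is projectively equivalent to $\mathcal C$; such a normal form exists, and the number does not depend on its choice. Then $\mathcal C$ has exactly nine flex points, and the following hold. (1) Let $N(\mathbb P^2,\mathcal C)$ consist of the identity and all elements of $\mathrm{Aut}(\mathbb P^2,\mathcal C)$ which have no fixed point on $\mathcal C$. Then $N(\mathbb P^2,\mathcal C)$ is a normal subgroup of $\mathrm{Aut}(\mathbb P^2,\mathcal C)$, it is isomorphic to $\mathbb Z/3\oplus\mathbb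 Z/3$, it is a maximal abelian subgroup of $\mathrm{Aut}(\mathbb P^2,\mathcal C)$, and it acts simply transitively on the set of nine flex points. (2) Let $\mathbf p_0$ be any flex point, and let $\mathrm{Aut}(\mathbb P^2,\mathcal C,\mathbf p_0)$ be the subgroup of all elements of $\mathrm{Aut}(\mathbb P^2,\mathcal C)$ which fix $\mathbf p_0$. There is a short exact sequence $$1\to N(\mathbb P^2,\mathcal C)\to \mathrm{Aut}(\mathbb P^2,\mathcal C)\to \mathrm{Aut}(\mathbb P^2,\mathcal C,\mathbf p_0)\to 1$$ whose first map is the inclusion and which is split by the inclusion of $\mathrm{Aut}(\mathbb P^2,\mathcal C,\mathbf p_0)$ in $\mathrm{Aut}(\mathbb P^2,\mathcal C)$. (3) For every flex point $\mathbf p_0$ the group $\mathrm{Aut}(\mathbb P^2,\mathcal C,\mathbf p_0)$ is cyclic, of order six if $J(\mathcal C)=0$, of order four if $J(\mathcal C)=1$, and of order two in all other cases. Thus $\mathrm{Aut}(\mathbb P^2,\mathcal C)$ has order $54$ if $J(\mathcal C)=0$, order $36$ if $J(\mathcal C)=1$, and order $18$ in all other cases. -/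

import Mathlib

open scoped LinearAlgebra.Projectivization

namespace PlaneCubic

/-- The complex projective plane `ℙ²(ℂ)`, the points being the lines through `0` in `ℂ³`. -/
abbrev P2 : Type := ℙ ℂ (Fin 3 → ℂ)

/-- The locus `Φ = 0` in `ℙ²(ℂ)`. For homogeneous `Φ` the condition does not depend on the
representative of the point. -/
def curve (Φ : MvPolynomial (Fin 3) ℂ) : Set P2 :=
  {p | MvPolynomial.eval p.rep Φ = 0}

/-- The partial derivative of `Φ` with respect to the `i`-th variable, at the vector `v`. -/
noncomputable def partialAt (Φ : MvPolynomial (Fin 3) ℂ) (i : Fin 3) (v : Fin 3 → ℂ) : ℂ :=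
  MvPolynomial.eval v (MvPolynomial.pderiv i Φ)

/-- A point of `Φ = 0` is singular if all three partial derivatives vanish there. -/
def IsSingularPoint (Φ : MvPolynomial (Fin 3) ℂ) (p : P2) : Prop :=
  p ∈ curve Φ ∧ ∀ i, partialAt Φ i p.rep = 0

/-- The curve `Φ = 0` is smooth if it has no singular points. -/
def IsSmooth (Φ : MvPolynomial (Fin 3) ℂ) : Prop :=
  ∀ p, ¬ IsSingularPoint Φ p

/-- The restriction of `Φ` to the line through the points represented by linearly independent
vectors `v` and `w`, in the affine parameter `t ↦ v + t w`. -/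
noncomputable def restrictToLine (Φ : MvPolynomial (Fin 3) ℂ) (v w : Fin 3 → ℂ) :
    Polynomial ℂ :=
  MvPolynomial.aeval
    (fun i => Polynomial.C (v i) + Polynomial.C (w i) * Polynomial.X) Φ

/-- The intersection multiplicity, at the point represented by `v`, of the curve `Φ = 0` and the
line through the points represented by linearly independent vectors `v` and `w`: the order of
vanishing at `t = 0` of `Φ (v + t w)`. It is `⊤` if the line lies in the curve. -/
noncomputable def intersectionMultiplicity (Φ : MvPolynomial (Fin 3) ℂ)
    (v w : Fin 3 → ℂ) : ℕ∞ :=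
  emultiplicity (Polynomial.X : Polynomial ℂ) (restrictToLine Φ v w)

/-- The flex points: the nonsingular points `p` of the curve `Φ = 0` at which the curve and its
tangent line (of equation `Φ_x(p) x + Φ_y(p) y + Φ_z(p) z = 0`) have intersection multiplicity
at least three. The vector `w` represents any second point of the tangent line. -/
def flexPoints (Φ : MvPolynomial (Fin 3) ℂ) : Set P2 :=
  {p | p ∈ curve Φ ∧ ¬ IsSingularPoint Φ p ∧
    ∀ w : Fin 3 → ℂ, LinearIndependent ℂ ![p.rep, w] →
      ∑ i, partialAt Φ i p.rep * w i = 0 →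
        3 ≤ intersectionMultiplicity Φ p.rep w}

/-- `Aut(ℙ²)`: the group of projective automorphisms, that is, of the permutations of the points
of `ℙ²(ℂ)` which are induced by linear automorphisms of `ℂ³`. -/
noncomputable def autP2 : Subgroup (Equiv.Perm P2) :=
  (MulAction.toPermHom ((Fin 3 → ℂ) ≃ₗ[ℂ] (Fin 3 → ℂ)) P2).range

/-- `Aut(ℙ², 𝒞)`: the group of projective automorphisms which map `𝒞` onto itself. -/
noncomputable def autCurve (𝒞 : Set P2) : Subgroup (Equiv.Perm P2) where
  carrier := {g | g ∈ autP2 ∧ g '' 𝒞 = 𝒞}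
  one_mem' := ⟨one_mem _, by simp⟩
  mul_mem' := by
    rintro g h ⟨hg, hg'⟩ ⟨hh, hh'⟩
    refine ⟨mul_mem hg hh, ?_⟩
    rw [Equiv.Perm.coe_mul, Set.image_comp, hh', hg']
  inv_mem' := by
    rintro g ⟨hg, hg'⟩
    refine ⟨inv_mem hg, ?_⟩
    conv_lhs => rw [← hg', ← Set.image_comp, ← Equiv.Perm.coe_mul, inv_mul_cancel]
    simp

/-- Two subsets of `ℙ²(ℂ)` are projectively equivalent if a projective automorphism maps the
first onto the second. -/
def ProjectivelyEquivalent (𝒞 𝒞' : Set P2) : Prop :=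
  ∃ g ∈ autP2, g '' 𝒞 = 𝒞'

/-- The polynomial `-y²z + x³ + axz² + bz³` of the standard normal form `y² = x³ + ax + b`. -/
noncomputable def standardForm (a b : ℂ) : MvPolynomial (Fin 3) ℂ :=
  - (MvPolynomial.X 1 ^ 2 * MvPolynomial.X 2) + MvPolynomial.X 0 ^ 3
    + MvPolynomial.C a * MvPolynomial.X 0 * MvPolynomial.X 2 ^ 2
    + MvPolynomial.C b * MvPolynomial.X 2 ^ 3

/-- `j = 4a³ / (4a³ + 27b²)` for some curve `y² = x³ + ax + b` with `4a³ + 27b² ≠ 0` which is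
projectively equivalent to `𝒞`. -/
def IsJInvariant (𝒞 : Set P2) (j : ℂ) : Prop :=
  ∃ a b : ℂ, 4 * a ^ 3 + 27 * b ^ 2 ≠ 0 ∧
    ProjectivelyEquivalent 𝒞 (curve (standardForm a b)) ∧
      j = 4 * a ^ 3 / (4 * a ^ 3 + 27 * b ^ 2)

/-- `J(𝒞)`, the value of `4a³ / (4a³ + 27b²)` for a standard normal form of `𝒞`. -/
noncomputable def jInvariant (𝒞 : Set P2) : ℂ :=
  Classical.epsilon (IsJInvariant 𝒞)

end PlaneCubic

/-! Every automorphism `g` of the curve lifts to a linear `L` with `Φ ∘ L = c Φ`: a cubic form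
vanishing on the curve is a multiple of `Φ` (`exists_eval_eq_mul`). Rescaling `L` by `s` multiplies
both `det L` and `c` by `s ^ 3`, so `det L / c` depends on `g` alone and is a character of the
group. Geometrically it is the factor by which `g` scales the holomorphic differential. Its kernel
`translations Φ` is the group `N`. No group law on the curve is used; everything is read off from
two normal forms.

In the form `y² = x³ + ax + b`, with a flex at `[0 : 1 : 0]`, an automorphism fixing that flex is `s
· diag(u², u³, 1)` with `u⁴ a = a` and `u⁶ b = b` (`IsSimilitude.standardForm_eq`). Here `c = s³ u⁶`
and `det L = s³ u⁵`. So the stabilizer is a group of roots of unity, and it meets `translations Φ`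
trivially.

In the Hesse form `x³ + y³ + z³ = 3txyz`, the cyclic shift and `diag(1, ω, ω²)` generate a
projective group `(ℤ/3)²` inside `translations Φ`. It acts freely on the curve and transitively on
the flexes, which are cut out by `xyz = 0`. A translation fixing a flex is trivial, so this group is
all of `translations Φ`, and there are nine flexes.

An automorphism with `det L ≠ c` has a fixed point on the curve, by an eigenvalue argument
(`exists_eigenvector_on_cubic`); hence `translations Φ` is the `N` of the theorem. Simple
transitivity on flexes makes each flex stabilizer a complement of `N`, which gives the split
sequence and the orders `9 · 6`, `9 · 4`, `9 · 2`. It also reduces the uniqueness of `J` to normal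
forms taken at one and the same flex. Existence of a flex comes from the Hessian and Krull's height
theorem. -/

namespace PlaneCubic

/-! ### Ternary cubics, polarization and flexes -/

/-- The general ternary cubic form, in terms of its ten coefficients. -/
noncomputable def ternaryCubic (k : Fin 10 → ℂ) : MvPolynomial (Fin 3) ℂ :=
  .C (k 0) * .X 0 ^ 3 + .C (k 1) * .X 1 ^ 3 + .C (k 2) * .X 2 ^ 3
    + .C (k 3) * .X 0 ^ 2 * .X 1 + .C (k 4) * .X 0 ^ 2 * .X 2
    + .C (k 5) * .X 1 ^ 2 * .X 0 + .C (k 6) * .X 1 ^ 2 * .X 2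
    + .C (k 7) * .X 2 ^ 2 * .X 0 + .C (k 8) * .X 2 ^ 2 * .X 1
    + .C (k 9) * .X 0 * .X 1 * .X 2

theorem ternaryCubic_add (k l : Fin 10 → ℂ) :
    ternaryCubic (k + l) = ternaryCubic k + ternaryCubic l := by
  simp only [ternaryCubic, Pi.add_apply, map_add]; ring

theorem exists_ternaryCubic_monomial (d : Fin 3 →₀ ℕ) (hd : d 0 + d 1 + d 2 = 3) (c : ℂ) :
    ∃ k, MvPolynomial.monomial d c = ternaryCubic k := by
  have key : MvPolynomial.monomial d c =
      MvPolynomial.C c * (.X 0 ^ d 0 * .X 1 ^ d 1 * .X 2 ^ d 2) := by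
    rw [MvPolynomial.monomial_eq, Finsupp.prod_fintype _ _ (by simp), Fin.prod_univ_three]
  rw [key]
  have h0 : d 0 ≤ 3 := by omega
  have h1 : d 1 ≤ 3 := by omega
  have h2 : d 2 = 3 - d 0 - d 1 := by omega
  rw [h2]
  generalize d 0 = m at *
  generalize d 1 = n at *
  interval_cases m <;> interval_cases n <;> try omega
  · exact ⟨Pi.single 2 c, by simp [ternaryCubic]⟩
  · exact ⟨Pi.single 8 c, by simp [ternaryCubic]; ring⟩
  · exact ⟨Pi.single 6 c, by simp [ternaryCubic]; ring⟩
  · exact ⟨Pi.single 1 c, by simp [ternaryCubic]⟩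
  · exact ⟨Pi.single 7 c, by simp [ternaryCubic]; ring⟩
  · exact ⟨Pi.single 9 c, by simp [ternaryCubic]; ring⟩
  · exact ⟨Pi.single 5 c, by simp [ternaryCubic]; ring⟩
  · exact ⟨Pi.single 4 c, by simp [ternaryCubic]; ring⟩
  · exact ⟨Pi.single 3 c, by simp [ternaryCubic]; ring⟩
  · exact ⟨Pi.single 0 c, by simp [ternaryCubic]⟩

theorem exists_eq_ternaryCubic {Φ : MvPolynomial (Fin 3) ℂ} (hΦ : Φ.IsHomogeneous 3) :
    ∃ k, Φ = ternaryCubic k := by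
  rw [← MvPolynomial.support_sum_monomial_coeff Φ]
  refine Finset.sum_induction _ (fun p => ∃ k, p = ternaryCubic k) ?_ ?_ ?_
  · rintro _ _ ⟨k, rfl⟩ ⟨l, rfl⟩
    exact ⟨k + l, (ternaryCubic_add k l).symm⟩
  · exact ⟨0, by simp [ternaryCubic]⟩
  · intro d hd
    refine exists_ternaryCubic_monomial d ?_ _
    have := hΦ (MvPolynomial.mem_support_iff.1 hd)
    rw [Finsupp.weight_apply, Finsupp.sum_fintype _ _ (by simp), Fin.sum_univ_three] at this
    simpa using this

theorem isHomogeneous_ternaryCubic (k : Fin 10 → ℂ) : (ternaryCubic k).IsHomogeneous 3 := by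
  have hC (c : ℂ) := MvPolynomial.isHomogeneous_C (Fin 3) c
  have hX (i : Fin 3) := MvPolynomial.isHomogeneous_X ℂ i
  unfold ternaryCubic
  refine .add (.add (.add (.add (.add (.add (.add (.add (.add ?_ ?_) ?_) ?_) ?_) ?_) ?_) ?_) ?_) ?_
  · exact (hC _).mul ((hX _).pow 3)
  · exact (hC _).mul ((hX _).pow 3)
  · exact (hC _).mul ((hX _).pow 3)
  · exact ((hC _).mul ((hX _).pow 2)).mul (hX _)
  · exact ((hC _).mul ((hX _).pow 2)).mul (hX _)
  · exact ((hC _).mul ((hX _).pow 2)).mul (hX _)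
  · exact ((hC _).mul ((hX _).pow 2)).mul (hX _)
  · exact ((hC _).mul ((hX _).pow 2)).mul (hX _)
  · exact ((hC _).mul ((hX _).pow 2)).mul (hX _)
  · exact (((hC _).mul (hX _)).mul (hX _)).mul (hX _)

/-- The derivative of `Φ` at `v` in the direction `w`. -/
noncomputable def dirDeriv (Φ : MvPolynomial (Fin 3) ℂ) (v w : Fin 3 → ℂ) : ℂ :=
  ∑ i, partialAt Φ i v * w i

theorem eval_ternaryCubic (k : Fin 10 → ℂ) (v : Fin 3 → ℂ) :
    MvPolynomial.eval v (ternaryCubic k) =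
      k 0 * v 0 ^ 3 + k 1 * v 1 ^ 3 + k 2 * v 2 ^ 3
    + k 3 * v 0 ^ 2 * v 1 + k 4 * v 0 ^ 2 * v 2
    + k 5 * v 1 ^ 2 * v 0 + k 6 * v 1 ^ 2 * v 2
    + k 7 * v 2 ^ 2 * v 0 + k 8 * v 2 ^ 2 * v 1
    + k 9 * v 0 * v 1 * v 2 := by
  simp [ternaryCubic]

theorem dirDeriv_ternaryCubic (k : Fin 10 → ℂ) (v w : Fin 3 → ℂ) :
    dirDeriv (ternaryCubic k) v w =
      (3 * k 0 * v 0 ^ 2 + 2 * k 3 * v 0 * v 1 + 2 * k 4 * v 0 * v 2 + k 5 * v 1 ^ 2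
        + k 7 * v 2 ^ 2 + k 9 * v 1 * v 2) * w 0
      + (3 * k 1 * v 1 ^ 2 + k 3 * v 0 ^ 2 + 2 * k 5 * v 1 * v 0 + 2 * k 6 * v 1 * v 2
        + k 8 * v 2 ^ 2 + k 9 * v 0 * v 2) * w 1
      + (3 * k 2 * v 2 ^ 2 + k 4 * v 0 ^ 2 + k 6 * v 1 ^ 2 + 2 * k 7 * v 2 * v 0
        + 2 * k 8 * v 2 * v 1 + k 9 * v 0 * v 1) * w 2 := by
  simp [ternaryCubic, dirDeriv, partialAt, Fin.sum_univ_three, MvPolynomial.pderiv_X]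
  ring

variable {Φ Ψ Θ : MvPolynomial (Fin 3) ℂ}

theorem eval_add_smul (hΦ : Φ.IsHomogeneous 3) (v w : Fin 3 → ℂ) (s t : ℂ) :
    MvPolynomial.eval (s • v + t • w) Φ = s ^ 3 * MvPolynomial.eval v Φ
      + s ^ 2 * t * dirDeriv Φ v w + s * t ^ 2 * dirDeriv Φ w v
      + t ^ 3 * MvPolynomial.eval w Φ := by
  obtain ⟨k, rfl⟩ := exists_eq_ternaryCubic hΦ
  simp only [eval_ternaryCubic, dirDeriv_ternaryCubic, Pi.add_apply, Pi.smul_apply, smul_eq_mul]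
  ring

theorem eval_smul_of_cubic (hΦ : Φ.IsHomogeneous 3) (v : Fin 3 → ℂ) (s : ℂ) :
    MvPolynomial.eval (s • v) Φ = s ^ 3 * MvPolynomial.eval v Φ := by
  simpa using eval_add_smul hΦ v 0 s 0

theorem dirDeriv_self (hΦ : Φ.IsHomogeneous 3) (v : Fin 3 → ℂ) :
    dirDeriv Φ v v = 3 * MvPolynomial.eval v Φ := by
  obtain ⟨k, rfl⟩ := exists_eq_ternaryCubic hΦ
  simp only [eval_ternaryCubic, dirDeriv_ternaryCubic]
  ring

theorem dirDeriv_smul_left (hΦ : Φ.IsHomogeneous 3) (v w : Fin 3 → ℂ) (s : ℂ) :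
    dirDeriv Φ (s • v) w = s ^ 2 * dirDeriv Φ v w := by
  obtain ⟨k, rfl⟩ := exists_eq_ternaryCubic hΦ
  simp only [dirDeriv_ternaryCubic, Pi.smul_apply, smul_eq_mul]
  ring

theorem dirDeriv_smul_right (v w : Fin 3 → ℂ) (s : ℂ) :
    dirDeriv Φ v (s • w) = s * dirDeriv Φ v w := by
  simp only [dirDeriv, Pi.smul_apply, smul_eq_mul, Finset.mul_sum]
  exact Finset.sum_congr rfl fun _ _ => by ring

/-- Polarization: derivatives are recovered from values, so a linear map that scales the values of a
form scales its derivatives by the same factor, without a chain rule. -/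
theorem dirDeriv_eq_eval (hΦ : Φ.IsHomogeneous 3) (v w : Fin 3 → ℂ) :
    dirDeriv Φ v w = (MvPolynomial.eval (v + w) Φ - MvPolynomial.eval (v - w) Φ
      - 2 * MvPolynomial.eval w Φ) / 2 := by
  have h1 := eval_add_smul hΦ v w 1 1
  have h2 := eval_add_smul hΦ v w 1 (-1)
  simp only [one_smul, neg_smul, ← sub_eq_add_neg] at h1 h2
  rw [h1, h2]; ring

theorem forall_partialAt_eq_zero_iff (v : Fin 3 → ℂ) :
    (∀ i, partialAt Φ i v = 0) ↔ ∀ w, dirDeriv Φ v w = 0 := by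
  refine ⟨fun h w => by simp [dirDeriv, h], fun h i => ?_⟩
  simpa [dirDeriv, Pi.single_apply] using h (Pi.single i 1)

open Projectivization in
theorem mk_mem_curve_iff (hΦ : Φ.IsHomogeneous 3) {v : Fin 3 → ℂ} (hv : v ≠ 0) :
    mk ℂ v hv ∈ curve Φ ↔ MvPolynomial.eval v Φ = 0 := by
  obtain ⟨a, ha⟩ := exists_smul_eq_mk_rep ℂ v hv
  change MvPolynomial.eval (mk ℂ v hv).rep Φ = 0 ↔ _
  rw [← ha, Units.smul_def, eval_smul_of_cubic hΦ]
  simp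

open Projectivization in
theorem isSmooth_iff (hΦ : Φ.IsHomogeneous 3) :
    IsSmooth Φ ↔ ∀ v ≠ 0, MvPolynomial.eval v Φ = 0 → ∃ w, dirDeriv Φ v w ≠ 0 := by
  constructor
  · intro h v hv h0
    by_contra! hw
    refine h (mk ℂ v hv) ⟨(mk_mem_curve_iff hΦ hv).2 h0, ?_⟩
    obtain ⟨a, ha⟩ := exists_smul_eq_mk_rep ℂ v hv
    rw [forall_partialAt_eq_zero_iff, ← ha, Units.smul_def]
    intro w
    rw [dirDeriv_smul_left hΦ, hw, mul_zero]
  · rintro h p ⟨hp, hs⟩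
    obtain ⟨w, hw⟩ := h p.rep p.rep_nonzero hp
    exact hw ((forall_partialAt_eq_zero_iff _).1 hs w)

theorem restrictToLine_eq (hΦ : Φ.IsHomogeneous 3) (v w : Fin 3 → ℂ) :
    restrictToLine Φ v w = Polynomial.C (MvPolynomial.eval v Φ)
      + Polynomial.C (dirDeriv Φ v w) * Polynomial.X
      + Polynomial.C (dirDeriv Φ w v) * Polynomial.X ^ 2
      + Polynomial.C (MvPolynomial.eval w Φ) * Polynomial.X ^ 3 := by
  refine Polynomial.funext fun t => ?_
  have h := eval_add_smul hΦ v w 1 t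
  have h2 : Polynomial.eval t (restrictToLine Φ v w) = MvPolynomial.eval (v + t • w) Φ := by
    obtain ⟨k, rfl⟩ := exists_eq_ternaryCubic hΦ
    rw [eval_ternaryCubic]
    simp [restrictToLine, ternaryCubic]
    ring
  rw [one_smul] at h
  rw [h2, h]
  simp
  ring

theorem three_le_intersectionMultiplicity_iff (hΦ : Φ.IsHomogeneous 3) (v w : Fin 3 → ℂ) :
    3 ≤ intersectionMultiplicity Φ v w ↔
      MvPolynomial.eval v Φ = 0 ∧ dirDeriv Φ v w = 0 ∧ dirDeriv Φ w v = 0 := by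
  rw [intersectionMultiplicity, restrictToLine_eq hΦ]
  change ((3 : ℕ) : ℕ∞) ≤ _ ↔ _
  rw [← pow_dvd_iff_le_emultiplicity, Polynomial.X_pow_dvd_iff]
  constructor
  · intro h
    refine ⟨?_, ?_, ?_⟩
    · simpa [Polynomial.coeff_X, Polynomial.coeff_C] using h 0 (by norm_num)
    · simpa [Polynomial.coeff_X, Polynomial.coeff_C] using h 1 (by norm_num)
    · simpa [Polynomial.coeff_X, Polynomial.coeff_C] using h 2 (by norm_num)
  · rintro ⟨h0, h1, h2⟩ d hd
    interval_cases d <;> simp [Polynomial.coeff_C, h0, h1, h2]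

/-- The vector `v` represents a flex point of `Φ = 0`, expressed by directional derivatives. -/
def IsFlexVector (Φ : MvPolynomial (Fin 3) ℂ) (v : Fin 3 → ℂ) : Prop :=
  MvPolynomial.eval v Φ = 0 ∧ (∃ w, dirDeriv Φ v w ≠ 0) ∧
    ∀ w, dirDeriv Φ v w = 0 → dirDeriv Φ w v = 0

theorem isFlexVector_smul (hΦ : Φ.IsHomogeneous 3) {v : Fin 3 → ℂ} {s : ℂ} (hs : s ≠ 0) :
    IsFlexVector Φ (s • v) ↔ IsFlexVector Φ v := by
  simp [IsFlexVector, eval_smul_of_cubic hΦ, dirDeriv_smul_left hΦ, dirDeriv_smul_right, hs]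

open Projectivization in
theorem mk_mem_flexPoints_iff (hΦ : Φ.IsHomogeneous 3) {v : Fin 3 → ℂ} (hv : v ≠ 0) :
    mk ℂ v hv ∈ flexPoints Φ ↔ IsFlexVector Φ v := by
  obtain ⟨a, ha⟩ := exists_smul_eq_mk_rep ℂ v hv
  rw [← isFlexVector_smul hΦ a.ne_zero, ← Units.smul_def, ha]
  set p := mk ℂ v hv
  change p ∈ curve Φ ∧ ¬ (p ∈ curve Φ ∧ _) ∧ (∀ w, _ → dirDeriv Φ p.rep w = 0 → _) ↔ _
  simp only [three_le_intersectionMultiplicity_iff hΦ, forall_partialAt_eq_zero_iff]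
  constructor
  · rintro ⟨h0, h1, h2⟩
    refine ⟨h0, by simpa [h0] using h1, fun w hw => ?_⟩
    -- A `w` dependent on the point is a multiple of it, and Euler's relation covers that case; so
    -- independence can be dropped from the flex condition.
    by_cases hli : LinearIndependent ℂ ![p.rep, w]
    · exact (h2 w hli hw).2.2
    · rw [LinearIndependent.pair_iff' p.rep_nonzero] at hli
      push Not at hli
      obtain ⟨b, rfl⟩ := hli
      rw [dirDeriv_smul_left hΦ, dirDeriv_self hΦ, show MvPolynomial.eval p.rep Φ = 0 from h0]
      ring
  · rintro ⟨h0, ⟨w, hw⟩, h2⟩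
    exact ⟨h0, fun h => hw (h.2 w), fun w _ hw => ⟨h0, hw, h2 w hw⟩⟩

/-! ### Similitudes of cubic forms and projective automorphisms -/

/-- The linear automorphism `L` pulls the form `Φ` back to `c Ψ`, with `c ≠ 0`. -/
def IsSimilitude (Φ Ψ : MvPolynomial (Fin 3) ℂ) (L : (Fin 3 → ℂ) ≃ₗ[ℂ] (Fin 3 → ℂ)) (c : ℂ) :
    Prop :=
  c ≠ 0 ∧ ∀ v, MvPolynomial.eval (L v) Φ = c * MvPolynomial.eval v Ψ

namespace IsSimilitude

variable {L M : (Fin 3 → ℂ) ≃ₗ[ℂ] (Fin 3 → ℂ)} {c d : ℂ}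

theorem one (Φ : MvPolynomial (Fin 3) ℂ) : IsSimilitude Φ Φ 1 1 :=
  ⟨one_ne_zero, fun v => by simp⟩

theorem mul (hL : IsSimilitude Φ Ψ L c) (hM : IsSimilitude Ψ Θ M d) :
    IsSimilitude Φ Θ (L * M) (c * d) :=
  ⟨mul_ne_zero hL.1 hM.1, fun v => by
    rw [LinearEquiv.mul_apply, hL.2, hM.2, mul_assoc]⟩

theorem inv (hL : IsSimilitude Φ Ψ L c) : IsSimilitude Ψ Φ L⁻¹ c⁻¹ :=
  ⟨inv_ne_zero hL.1, fun v => by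
    have := hL.2 (L⁻¹ v)
    rw [← LinearEquiv.mul_apply, mul_inv_cancel] at this
    rw [show (1 : (Fin 3 → ℂ) ≃ₗ[ℂ] (Fin 3 → ℂ)) v = v from rfl] at this
    rw [this, inv_mul_cancel_left₀ hL.1]⟩

theorem dirDeriv_apply (hΦ : Φ.IsHomogeneous 3) (hΨ : Ψ.IsHomogeneous 3)
    (h : IsSimilitude Φ Ψ L c) (v w : Fin 3 → ℂ) :
    dirDeriv Φ (L v) (L w) = c * dirDeriv Ψ v w := by
  rw [dirDeriv_eq_eval hΦ, dirDeriv_eq_eval hΨ, ← map_add, ← map_sub, h.2, h.2, h.2]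
  ring

theorem isFlexVector_iff (hΦ : Φ.IsHomogeneous 3) (hΨ : Ψ.IsHomogeneous 3)
    (h : IsSimilitude Φ Ψ L c) (v : Fin 3 → ℂ) :
    IsFlexVector Φ (L v) ↔ IsFlexVector Ψ v := by
  unfold IsFlexVector
  rw [L.surjective.exists, L.surjective.forall]
  simp [h.dirDeriv_apply hΦ hΨ, h.2, h.1]

theorem isSmooth (hΦ : Φ.IsHomogeneous 3) (hΨ : Ψ.IsHomogeneous 3)
    (h : IsSimilitude Φ Ψ L c) (hs : IsSmooth Φ) : IsSmooth Ψ := by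
  rw [isSmooth_iff hΨ]
  rw [isSmooth_iff hΦ] at hs
  intro v hv h0
  obtain ⟨w, hw⟩ := hs (L v) (by simpa using hv) (by rw [h.2, h0, mul_zero])
  obtain ⟨w, rfl⟩ := L.surjective w
  rw [h.dirDeriv_apply hΦ hΨ] at hw
  exact ⟨w, right_ne_zero_of_mul hw⟩

end IsSimilitude

theorem exists_pullback (hΦ : Φ.IsHomogeneous 3) (L : (Fin 3 → ℂ) →ₗ[ℂ] (Fin 3 → ℂ)) :
    ∃ Ψ : MvPolynomial (Fin 3) ℂ, Ψ.IsHomogeneous 3 ∧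
      ∀ v, MvPolynomial.eval v Ψ = MvPolynomial.eval (L v) Φ := by
  let g : Fin 3 → MvPolynomial (Fin 3) ℂ :=
    fun i => ∑ j, MvPolynomial.C (L (Pi.single j 1) i) * MvPolynomial.X j
  refine ⟨MvPolynomial.aeval g Φ, ?_, fun v => ?_⟩
  · simpa using hΦ.aeval g fun i => MvPolynomial.IsHomogeneous.sum _ _ _ fun j _ =>
      MvPolynomial.isHomogeneous_C_mul_X _ _
  · have hv : L v = fun i => MvPolynomial.eval v (g i) := by
      ext i
      conv_lhs => rw [← Finset.univ_sum_single v]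
      simp only [g, map_sum, map_mul, MvPolynomial.eval_C, MvPolynomial.eval_X, Finset.sum_apply]
      refine Finset.sum_congr rfl fun j _ => ?_
      have : (Pi.single j (v j) : Fin 3 → ℂ) = v j • Pi.single j 1 := by
        rw [← Pi.single_smul]; simp
      rw [this, map_smul]
      simp [mul_comm]
    rw [hv, MvPolynomial.aeval_def, MvPolynomial.eval₂_eq_eval_map]
    obtain ⟨k, rfl⟩ := exists_eq_ternaryCubic hΦ
    rw [eval_ternaryCubic]
    simp [ternaryCubic]

section Projective

open Projectivization

/-- The projective automorphism induced by a linear automorphism. -/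
noncomputable def projAut : ((Fin 3 → ℂ) ≃ₗ[ℂ] (Fin 3 → ℂ)) →* Equiv.Perm P2 :=
  MulAction.toPermHom ((Fin 3 → ℂ) ≃ₗ[ℂ] (Fin 3 → ℂ)) P2

theorem projAut_mk (L : (Fin 3 → ℂ) ≃ₗ[ℂ] (Fin 3 → ℂ)) {v : Fin 3 → ℂ} (hv : v ≠ 0) :
    projAut L (mk ℂ v hv) = mk ℂ (L v) (by simpa using hv) := rfl

theorem mem_autP2_iff {g : Equiv.Perm P2} : g ∈ autP2 ↔ ∃ L, projAut L = g := Iff.rfl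

theorem IsSimilitude.image_curve {L : (Fin 3 → ℂ) ≃ₗ[ℂ] (Fin 3 → ℂ)} {c : ℂ}
    (hΦ : Φ.IsHomogeneous 3) (hΨ : Ψ.IsHomogeneous 3)
    (h : IsSimilitude Φ Ψ L c) : projAut L '' curve Ψ = curve Φ := by
  ext p
  rw [Equiv.image_eq_preimage_symm, Set.mem_preimage]
  obtain ⟨q, rfl⟩ := (projAut L).surjective p
  rw [Equiv.symm_apply_apply]
  induction q using Projectivization.ind with
  | _ v hv =>
    rw [projAut_mk, mk_mem_curve_iff hΦ, mk_mem_curve_iff hΨ, h.2]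
    simp [h.1]

theorem projAut_eq_one_iff {L : (Fin 3 → ℂ) ≃ₗ[ℂ] (Fin 3 → ℂ)} :
    projAut L = 1 ↔ ∃ s : ℂ, ∀ v, L v = s • v := by
  constructor
  · intro h
    obtain ⟨a, ha⟩ := L.toLinearMap.exists_eq_smul_id_of_forall_notLinearIndependent fun v => by
      by_cases hv : v = 0
      · simp [hv, linearIndependent_fin2]
      · have h1 : projAut L (mk ℂ v hv) = mk ℂ v hv := by rw [h]; rfl
        rw [projAut_mk, mk_eq_mk_iff'] at h1
        obtain ⟨a, ha⟩ := h1
        rw [LinearIndependent.pair_iff' hv]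
        push Not
        exact ⟨a, ha⟩
    exact ⟨a, fun v => LinearMap.congr_fun ha v⟩
  · rintro ⟨s, hs⟩
    ext p
    induction p using Projectivization.ind with
    | _ v hv =>
      rw [projAut_mk]
      exact (mk_eq_mk_iff' _ _ _ _ _).2 ⟨s, (hs v).symm⟩

theorem projAut_mk_eq_iff {L : (Fin 3 → ℂ) ≃ₗ[ℂ] (Fin 3 → ℂ)} {v w : Fin 3 → ℂ} (hv : v ≠ 0)
    (hw : w ≠ 0) : projAut L (mk ℂ v hv) = mk ℂ w hw ↔ ∃ s : ℂ, L v = s • w := by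
  rw [projAut_mk, mk_eq_mk_iff']
  simp [eq_comm]

end Projective
-- Existence of a flex: Krull's height theorem and the Hessian
/-- Specialisation of the variables with index below `s` to zero. -/
noncomputable def killBelow (s : ℕ) : MvPolynomial (Fin 3) ℂ →ₐ[ℂ] MvPolynomial (Fin 3) ℂ :=
  MvPolynomial.aeval fun i => if (i : ℕ) < s then 0 else MvPolynomial.X i

/-- Links of the chain `0 ⊂ (X₀) ⊂ (X₀, X₁) ⊂ (X₀, X₁, X₂)`, realized as kernels so that primality
is automatic. -/
theorem ker_killBelow_lt (s : Fin 3) :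
    RingHom.ker (killBelow s) < RingHom.ker (killBelow (s + 1)) := by
  refine lt_of_le_of_ne ?_ fun h => ?_
  · have key : (killBelow (s + 1)).comp (killBelow s) = killBelow (s + 1) := by
      refine MvPolynomial.algHom_ext fun i => ?_
      simp only [killBelow, AlgHom.comp_apply, MvPolynomial.aeval_X]
      by_cases h1 : (i : ℕ) < s
      · rw [if_pos h1, if_pos (by omega), map_zero]
      · rw [if_neg h1, MvPolynomial.aeval_X]
    intro p hp
    rw [RingHom.mem_ker] at hp ⊢
    rw [← key, AlgHom.comp_apply, hp, map_zero]
  · have h1 : MvPolynomial.X s ∈ RingHom.ker (killBelow (s + 1)) := by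
      simp [RingHom.mem_ker, killBelow]
    rw [← h, RingHom.mem_ker] at h1
    simp [killBelow] at h1

theorem three_le_height_vanishingIdeal_zero :
    3 ≤ (MvPolynomial.vanishingIdeal ℂ {(0 : Fin 3 → ℂ)} :
      Ideal (MvPolynomial (Fin 3) ℂ)).height := by
  have hp (s : ℕ) : (RingHom.ker (killBelow s)).IsPrime := RingHom.ker_isPrime _
  have h0 := Ideal.height_add_one_le_of_lt_of_isPrime (ker_killBelow_lt 0)
  have h1 := Ideal.height_add_one_le_of_lt_of_isPrime (ker_killBelow_lt 1)
  have h2 := Ideal.height_add_one_le_of_lt_of_isPrime (ker_killBelow_lt 2)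
  have h3 : RingHom.ker (killBelow 3) ≤ MvPolynomial.vanishingIdeal ℂ {(0 : Fin 3 → ℂ)} := by
    intro p hp
    rw [MvPolynomial.mem_vanishingIdeal_singleton_iff]
    have key : (MvPolynomial.aeval (R := ℂ) (0 : Fin 3 → ℂ)).comp (killBelow 3)
        = MvPolynomial.aeval (R := ℂ) (0 : Fin 3 → ℂ) := by
      refine MvPolynomial.algHom_ext fun i => ?_
      simp [killBelow]
    rw [← key, AlgHom.comp_apply, (RingHom.mem_ker).1 hp, map_zero]
  refine le_trans ?_ (Ideal.height_mono h3)
  simp only [Fin.val_zero, Fin.val_one, Fin.val_two, zero_add, Nat.reduceAdd] at h0 h1 h2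
  calc (3 : ℕ∞) = 0 + 1 + 1 + 1 := by norm_num
    _ ≤ _ := by
      refine le_trans ?_ h2
      gcongr
      refine le_trans ?_ h1
      gcongr
      exact le_trans (by gcongr; exact zero_le) h0

-- If the origin were the only common zero, the Nullstellensatz would make its maximal ideal the
-- radical of `(F, G)`. That ideal has height at least three, but Krull bounds the height of a
-- minimal prime over two generators by two.
open MvPolynomial in
theorem exists_common_zero (F G : MvPolynomial (Fin 3) ℂ) (hF : eval 0 F = 0) (hG : eval 0 G = 0) :
    ∃ v ≠ 0, eval v F = 0 ∧ eval v G = 0 := by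
  by_contra! h
  have h1 : zeroLocus ℂ (Ideal.span {F, G}) = {(0 : Fin 3 → ℂ)} := by
    ext v
    rw [zeroLocus_span]
    simp only [Set.mem_insert_iff, Set.mem_singleton_iff, forall_eq_or_imp, forall_eq,
      Set.mem_ofPred_eq]
    constructor
    · rintro ⟨a, b⟩
      by_contra hv
      exact h v hv (by simpa using a) (by simpa using b)
    · rintro rfl
      exact ⟨by simpa using hF, by simpa using hG⟩
  have h2 := vanishingIdeal_zeroLocus_eq_radical (k := ℂ) (K := ℂ) (Ideal.span {F, G})
  rw [h1] at h2
  have h3 : (vanishingIdeal ℂ {(0 : Fin 3 → ℂ)} : Ideal (MvPolynomial (Fin 3) ℂ)) ∈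
      (Ideal.span {F, G}).minimalPrimes := by
    rw [← Ideal.radical_minimalPrimes, ← h2, Ideal.minimalPrimes_eq_subsingleton_self]
    rfl
  have h4 := three_le_height_vanishingIdeal_zero.trans
    (Ideal.height_le_card_of_mem_minimalPrimes_span (Set.toFinite _) h3)
  have h5 := Set.ncard_insert_le F {G}
  rw [Set.ncard_singleton] at h5
  have h6 : 3 ≤ ({F, G} : Set (MvPolynomial (Fin 3) ℂ)).ncard := by exact_mod_cast h4
  omega

/-- The Hessian matrix of `Φ` at the vector `v`. -/
noncomputable def hessianMatrix (Φ : MvPolynomial (Fin 3) ℂ) (v : Fin 3 → ℂ) :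
    Matrix (Fin 3) (Fin 3) ℂ :=
  Matrix.of fun i j => MvPolynomial.eval v (MvPolynomial.pderiv i (MvPolynomial.pderiv j Φ))

/-- The Hessian determinant of `Φ`. -/
noncomputable def hessian (Φ : MvPolynomial (Fin 3) ℂ) : MvPolynomial (Fin 3) ℂ :=
  (Matrix.of fun i j => MvPolynomial.pderiv i (MvPolynomial.pderiv j Φ)).det

theorem eval_hessian (v : Fin 3 → ℂ) :
    MvPolynomial.eval v (hessian Φ) = (hessianMatrix Φ v).det := by
  rw [hessian, RingHom.map_det]
  rfl

theorem hessianMatrix_ternaryCubic (k : Fin 10 → ℂ) (v : Fin 3 → ℂ) :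
    hessianMatrix (ternaryCubic k) v =
      !![6 * k 0 * v 0 + 2 * k 3 * v 1 + 2 * k 4 * v 2,
          2 * k 3 * v 0 + 2 * k 5 * v 1 + k 9 * v 2,
          2 * k 4 * v 0 + 2 * k 7 * v 2 + k 9 * v 1;
        2 * k 3 * v 0 + 2 * k 5 * v 1 + k 9 * v 2,
          6 * k 1 * v 1 + 2 * k 5 * v 0 + 2 * k 6 * v 2,
          2 * k 6 * v 1 + 2 * k 8 * v 2 + k 9 * v 0;
        2 * k 4 * v 0 + 2 * k 7 * v 2 + k 9 * v 1,
          2 * k 6 * v 1 + 2 * k 8 * v 2 + k 9 * v 0,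
          6 * k 2 * v 2 + 2 * k 7 * v 0 + 2 * k 8 * v 1] := by
  have h2 (i : Fin 3) : MvPolynomial.pderiv i (2 : MvPolynomial (Fin 3) ℂ) = 0 :=
    (MvPolynomial.pderiv i).map_natCast 2
  have h3 (i : Fin 3) : MvPolynomial.pderiv i (3 : MvPolynomial (Fin 3) ℂ) = 0 :=
    (MvPolynomial.pderiv i).map_natCast 3
  ext i j
  fin_cases i <;> fin_cases j <;>
    simp [hessianMatrix, ternaryCubic, MvPolynomial.pderiv_X, h2, h3] <;> ring

/-- The Hessian matrix as a quadratic form in the frame `v, w, u`, evaluated by Euler's relations.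
The entries `a`, `b` stay unspecified: if `Φ v` and the derivative along `w` vanish, they drop out
of the determinant. -/
theorem gram_hessianMatrix (hΦ : Φ.IsHomogeneous 3) (v w u : Fin 3 → ℂ) :
    ∃ a b : ℂ, !![v 0, v 1, v 2; w 0, w 1, w 2; u 0, u 1, u 2] * hessianMatrix Φ v *
      !![v 0, w 0, u 0; v 1, w 1, u 1; v 2, w 2, u 2] =
      !![6 * MvPolynomial.eval v Φ, 2 * dirDeriv Φ v w, 2 * dirDeriv Φ v u;
        2 * dirDeriv Φ v w, 2 * dirDeriv Φ w v, a;
        2 * dirDeriv Φ v u, a, b] := by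
  obtain ⟨k, rfl⟩ := exists_eq_ternaryCubic hΦ
  rw [hessianMatrix_ternaryCubic]
  simp only [eval_ternaryCubic, dirDeriv_ternaryCubic]
  set G := !![v 0, v 1, v 2; w 0, w 1, w 2; u 0, u 1, u 2] * _ *
    !![v 0, w 0, u 0; v 1, w 1, u 1; v 2, w 2, u 2] with hG
  refine ⟨G 1 2, G 2 2, ?_⟩
  ext i j
  fin_cases i <;> fin_cases j <;>
    simp [hG, -mul_eq_mul_left_iff] <;> ring

theorem det_sq_mul_hessian (hΦ : Φ.IsHomogeneous 3) {v w : Fin 3 → ℂ} (u : Fin 3 → ℂ)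
    (h0 : MvPolynomial.eval v Φ = 0) (hw : dirDeriv Φ v w = 0) :
    !![v 0, v 1, v 2; w 0, w 1, w 2; u 0, u 1, u 2].det ^ 2 * MvPolynomial.eval v (hessian Φ) =
      - 8 * dirDeriv Φ v u ^ 2 * dirDeriv Φ w v := by
  obtain ⟨a, b, h⟩ := gram_hessianMatrix hΦ v w u
  have h1 := congrArg Matrix.det h
  have h2 : !![v 0, w 0, u 0; v 1, w 1, u 1; v 2, w 2, u 2].det =
    !![v 0, v 1, v 2; w 0, w 1, w 2; u 0, u 1, u 2].det := by
    simp [Matrix.det_fin_three]; ring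
  rw [Matrix.det_mul, Matrix.det_mul, h2, h0, hw,
    Matrix.det_fin_three !![6 * 0, _, _; _, _, _; _, _, _]] at h1
  simp only [Matrix.of_apply, Matrix.cons_val] at h1
  rw [eval_hessian]
  linear_combination h1

/-- With `n` the gradient at `v`, take `w = n × eᵢ` where `v i ≠ 0`. Then `det(v, w, u) = vᵢ (n · u)
- uᵢ (n · v)`, and `n · v = 0` by Euler. -/
theorem exists_tangent_frame (hΦ : Φ.IsHomogeneous 3) {v : Fin 3 → ℂ} (hv : v ≠ 0)
    (h0 : MvPolynomial.eval v Φ = 0) {u : Fin 3 → ℂ} (hu : dirDeriv Φ v u ≠ 0) :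
    ∃ w, dirDeriv Φ v w = 0 ∧ !![v 0, v 1, v 2; w 0, w 1, w 2; u 0, u 1, u 2].det ≠ 0 := by
  obtain ⟨i, hi⟩ := Function.ne_iff.1 hv
  let n : Fin 3 → ℂ := fun i => partialAt Φ i v
  have hn (w) : dirDeriv Φ v w = n 0 * w 0 + n 1 * w 1 + n 2 * w 2 := by
    simp [dirDeriv, Fin.sum_univ_three, n]
  have hself := dirDeriv_self hΦ v
  rw [h0, hn] at hself
  obtain ⟨w, hw, hdet⟩ : ∃ w, dirDeriv Φ v w = 0 ∧
      !![v 0, v 1, v 2; w 0, w 1, w 2; u 0, u 1, u 2].det = v i * dirDeriv Φ v u := by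
    simp only [hn, Matrix.det_fin_three]
    fin_cases i
    · exact ⟨![0, n 2, - n 1], by simp; ring, by simp; linear_combination -u 0 * hself⟩
    · exact ⟨![- n 2, 0, n 0], by simp; ring, by simp; linear_combination -u 1 * hself⟩
    · exact ⟨![n 1, - n 0, 0], by simp; ring, by simp; linear_combination -u 2 * hself⟩
  exact ⟨w, hw, hdet ▸ mul_ne_zero hi hu⟩

theorem eval_hessian_of_isFlexVector (hΦ : Φ.IsHomogeneous 3) {v : Fin 3 → ℂ} (hv : v ≠ 0)
    (h : IsFlexVector Φ v) : MvPolynomial.eval v (hessian Φ) = 0 := by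
  obtain ⟨h0, ⟨u, hu⟩, h2⟩ := h
  obtain ⟨w, hw, hdet⟩ := exists_tangent_frame hΦ hv h0 hu
  have := det_sq_mul_hessian hΦ u h0 hw
  rw [h2 w hw, mul_zero] at this
  exact (mul_eq_zero.1 this).resolve_left (pow_ne_zero 2 hdet)

theorem isFlexVector_of_eval_hessian (hΦ : Φ.IsHomogeneous 3) {v : Fin 3 → ℂ}
    (h0 : MvPolynomial.eval v Φ = 0) (hs : ∃ w, dirDeriv Φ v w ≠ 0)
    (h : MvPolynomial.eval v (hessian Φ) = 0) : IsFlexVector Φ v := by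
  obtain ⟨u, hu⟩ := hs
  refine ⟨h0, ⟨u, hu⟩, fun w hw => ?_⟩
  have := det_sq_mul_hessian hΦ u h0 hw
  rw [h, mul_zero] at this
  simpa [hu] using this.symm

theorem exists_isFlexVector (hΦ : Φ.IsHomogeneous 3) (hs : IsSmooth Φ) :
    ∃ v ≠ 0, IsFlexVector Φ v := by
  obtain ⟨v, hv, h0, h1⟩ := exists_common_zero Φ (hessian Φ)
    (by simpa using eval_smul_of_cubic hΦ 0 0) (by
      obtain ⟨k, rfl⟩ := exists_eq_ternaryCubic hΦ
      rw [eval_hessian, hessianMatrix_ternaryCubic]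
      simp [Matrix.det_fin_three])
  exact ⟨v, hv, isFlexVector_of_eval_hessian hΦ h0 ((isSmooth_iff hΦ).1 hs v hv h0) h1⟩

/-! ### The normal form `y² = x³ + ax + b` at a flex -/

theorem exists_linearEquiv_mulVec (M : Matrix (Fin 3) (Fin 3) ℂ) (hM : M.det ≠ 0) :
    ∃ L : (Fin 3 → ℂ) ≃ₗ[ℂ] (Fin 3 → ℂ), ∀ v, L v = M.mulVec v := by
  have h : IsUnit (LinearMap.det (Matrix.toLin' M)) := by
    rw [LinearMap.det_toLin']; exact hM.isUnit
  refine ⟨LinearEquiv.ofIsUnitDet (f := Matrix.toLin' M)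
    (v := Pi.basisFun ℂ (Fin 3)) (v' := Pi.basisFun ℂ (Fin 3)) ?_, fun v => ?_⟩
  · rwa [LinearMap.det_toMatrix]
  · simp

theorem standardForm_eq_ternaryCubic (a b : ℂ) :
    standardForm a b = ternaryCubic ![1, 0, b, 0, 0, 0, -1, a, 0, 0] := by
  simp [standardForm, ternaryCubic, Matrix.cons_val]
  ring

theorem isHomogeneous_standardForm (a b : ℂ) : (standardForm a b).IsHomogeneous 3 := by
  rw [standardForm_eq_ternaryCubic]; exact isHomogeneous_ternaryCubic _

theorem eval_standardForm (a b : ℂ) (v : Fin 3 → ℂ) :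
    MvPolynomial.eval v (standardForm a b) =
      - (v 1 ^ 2 * v 2) + v 0 ^ 3 + a * v 0 * v 2 ^ 2 + b * v 2 ^ 3 := by
  simp [standardForm]

theorem dirDeriv_standardForm (a b : ℂ) (v w : Fin 3 → ℂ) :
    dirDeriv (standardForm a b) v w = (3 * v 0 ^ 2 + a * v 2 ^ 2) * w 0 - 2 * v 1 * v 2 * w 1
      + (- v 1 ^ 2 + 2 * a * v 0 * v 2 + 3 * b * v 2 ^ 2) * w 2 := by
  rw [standardForm_eq_ternaryCubic, dirDeriv_ternaryCubic]
  simp [Matrix.cons_val]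
  ring

theorem discriminant_ne_zero_of_isSmooth {a b : ℂ} (h : IsSmooth (standardForm a b)) :
    4 * a ^ 3 + 27 * b ^ 2 ≠ 0 := by
  intro hd
  rw [isSmooth_iff (isHomogeneous_standardForm a b)] at h
  -- A double root of the cubic, which gives the singular point `[x : 0 : 1]`.
  obtain ⟨x, h1, h2⟩ : ∃ x, x ^ 3 + a * x + b = 0 ∧ 3 * x ^ 2 + a = 0 := by
    by_cases ha : a = 0
    · subst ha
      have hb : b = 0 := by simpa using hd
      exact ⟨0, by simp [hb], by simp⟩
    · refine ⟨- 3 * b / (2 * a), ?_, ?_⟩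
      · field_simp
        linear_combination (-b) * hd
      · field_simp
        linear_combination hd
  obtain ⟨w, hw⟩ := h ![x, 0, 1] (fun h => by simpa using congrFun h 2) (by
    simp [eval_standardForm]; linear_combination h1)
  apply hw
  simp [dirDeriv_standardForm]
  linear_combination w 0 * h2 + w 2 * (3 * h1 - x * h2)

theorem exists_standardForm_of_coeffs {k : Fin 10 → ℂ} (h1 : k 1 = 0) (h3 : k 3 = 0)
    (h5 : k 5 = 0) (h6 : k 6 ≠ 0) (hs : IsSmooth (ternaryCubic k)) :
    ∃ (L : (Fin 3 → ℂ) ≃ₗ[ℂ] (Fin 3 → ℂ)) (a b c : ℂ),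
      IsSimilitude (ternaryCubic k) (standardForm a b) L c ∧ L ![0, 1, 0] = ![0, 1, 0] := by
  have h0 : k 0 ≠ 0 := by
    intro h0
    -- Without the `x³` term the line `z = 0` is a component, and it meets the residual conic in a
    -- singular point `[1 : y : 0]`.
    obtain ⟨d, hd⟩ := IsAlgClosed.exists_pow_nat_eq (discrim (k 6) (k 9) (k 4)) (n := 2)
      (by norm_num)
    obtain ⟨y, hy⟩ := exists_quadratic_eq_zero h6 ⟨d, by rw [← hd]; ring⟩
    rw [isSmooth_iff (isHomogeneous_ternaryCubic k)] at hs
    obtain ⟨w, hw⟩ := hs ![1, y, 0] (fun h => by simpa using congrFun h 0)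
      (by simp [eval_ternaryCubic, h0, h1, h3, h5])
    apply hw
    simp [dirDeriv_ternaryCubic, h0, h1, h3, h5]
    left
    linear_combination hy
  -- Completing square and cube: `β`, `α`, `γ` remove the `xyz`, `x²z`, `yz²` terms, and `m`
  -- rescales `z` so that `y²z` gets the coefficient `-k 0`.
  obtain ⟨β, hβ⟩ : ∃ β, 2 * k 6 * β + k 9 = 0 := ⟨- k 9 / (2 * k 6), by field_simp; ring⟩
  obtain ⟨α, hα⟩ : ∃ α, 3 * k 0 * α + k 4 + k 6 * β ^ 2 + k 9 * β = 0 :=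
    ⟨- (k 4 + k 6 * β ^ 2 + k 9 * β) / (3 * k 0), by field_simp; ring⟩
  obtain ⟨γ, hγ⟩ : ∃ γ, 2 * k 6 * γ + k 8 + k 9 * α = 0 :=
    ⟨- (k 8 + k 9 * α) / (2 * k 6), by field_simp; ring⟩
  obtain ⟨m, hm⟩ : ∃ m, k 6 * m = - k 0 := ⟨- k 0 / k 6, by field_simp⟩
  have hm0 : m ≠ 0 := by rintro rfl; simp at hm; exact h0 hm
  have hdiv (x : ℂ) : ∃ a, k 0 * a = x := ⟨x / k 0, by field_simp⟩
  obtain ⟨a, ha⟩ : ∃ a, k 0 * a = m ^ 2 * (3 * k 0 * α ^ 2 + 2 * k 4 * α + 2 * k 6 * β * γ + k 7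
    + k 8 * β + k 9 * (γ + α * β)) := hdiv _
  obtain ⟨b, hb⟩ : ∃ b, k 0 * b = m ^ 3 * (k 0 * α ^ 3 + k 2 + k 4 * α ^ 2 + k 6 * γ ^ 2 + k 7 * α
    + k 8 * γ + k 9 * α * γ) := hdiv _
  obtain ⟨L, hL⟩ := exists_linearEquiv_mulVec !![1, 0, α * m; β, 1, γ * m; 0, 0, m]
    (by simpa [Matrix.det_fin_three] using hm0)
  refine ⟨L, a, b, k 0, ⟨h0, fun v => ?_⟩, ?_⟩
  · rw [eval_ternaryCubic, eval_standardForm, hL]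
    simp [Matrix.mulVec, dotProduct, Fin.sum_univ_three, h1, h3, h5]
    linear_combination v 1 ^ 2 * v 2 * hm - v 0 * v 2 ^ 2 * ha - v 2 ^ 3 * hb
      + m * v 0 ^ 2 * v 2 * hα + m * v 0 * v 1 * v 2 * hβ + m ^ 2 * v 1 * v 2 ^ 2 * hγ
  · rw [hL]
    ext i
    fin_cases i <;> simp [Matrix.mulVec, dotProduct, Fin.sum_univ_three]

/-- In coordinates with the flex at `[0 : 1 : 0]` and tangent line `z = 0`, the flex conditions say
that the coefficients of `y³`, `xy²` and `x²y` vanish; smoothness of the point keeps `y²z`. -/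
theorem exists_standardForm (hΦ : Φ.IsHomogeneous 3) (hs : IsSmooth Φ) {v : Fin 3 → ℂ}
    (hv : v ≠ 0) (h : IsFlexVector Φ v) :
    ∃ (L : (Fin 3 → ℂ) ≃ₗ[ℂ] (Fin 3 → ℂ)) (a b c : ℂ),
      IsSimilitude Φ (standardForm a b) L c ∧ L ![0, 1, 0] = v := by
  obtain ⟨h0, ⟨u, hu⟩, h2⟩ := id h
  obtain ⟨w, hw, hdet⟩ := exists_tangent_frame hΦ hv h0 hu
  obtain ⟨L, hL⟩ := exists_linearEquiv_mulVec
    !![w 0, v 0, u 0; w 1, v 1, u 1; w 2, v 2, u 2] (by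
      convert neg_ne_zero.2 hdet using 1
      simp [Matrix.det_fin_three]; ring)
  have hx : L ![1, 0, 0] = w := by
    rw [hL]; ext i; fin_cases i <;> simp [Matrix.mulVec, dotProduct, Fin.sum_univ_three]
  have hy : L ![0, 1, 0] = v := by
    rw [hL]; ext i; fin_cases i <;> simp [Matrix.mulVec, dotProduct, Fin.sum_univ_three]
  have hz : L ![0, 0, 1] = u := by
    rw [hL]; ext i; fin_cases i <;> simp [Matrix.mulVec, dotProduct, Fin.sum_univ_three]
  obtain ⟨Ψ, hΨ, hLΨ⟩ := exists_pullback hΦ L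
  obtain ⟨k, rfl⟩ := exists_eq_ternaryCubic hΨ
  have hsim : IsSimilitude Φ (ternaryCubic k) L 1 :=
    ⟨one_ne_zero, fun v => by rw [hLΨ, one_mul]; rfl⟩
  have hD (x y) : dirDeriv Φ (L x) (L y) = dirDeriv (ternaryCubic k) x y := by
    rw [hsim.dirDeriv_apply hΦ hΨ, one_mul]
  have h1 : k 1 = 0 := by
    have := hLΨ ![0, 1, 0]
    simpa [hy, h0, eval_ternaryCubic] using this
  have h5 : k 5 = 0 := by
    have := hD ![0, 1, 0] ![1, 0, 0]
    rw [hx, hy, hw] at this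
    simpa [dirDeriv_ternaryCubic] using this.symm
  have h3 : k 3 = 0 := by
    have := hD ![1, 0, 0] ![0, 1, 0]
    rw [hx, hy, h2 w hw] at this
    simpa [dirDeriv_ternaryCubic] using this.symm
  have h6 : k 6 ≠ 0 := by
    have := hD ![0, 1, 0] ![0, 0, 1]
    rw [hz, hy] at this
    rw [this] at hu
    simpa [dirDeriv_ternaryCubic] using hu
  obtain ⟨M, a, b, c, hM, hMy⟩ := exists_standardForm_of_coeffs h1 h3 h5 h6
    (hsim.isSmooth hΦ hΨ hs)
  exact ⟨L * M, a, b, _, hsim.mul hM, by rw [LinearEquiv.mul_apply, hMy, hy]⟩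

/-! ### Cubic forms vanishing on a smooth cubic are its multiples -/

section Proportional

-- Modulo `y² = f(t)` the form `Ψ` becomes `A(t) + B(t) y` at the affine points of the curve. Both
-- square roots `±y` occur over each `t`, so `A = 0` and `B f = 0`; the coefficients then give the
-- multiple.
open Polynomial in
theorem exists_eval_eq_mul_standardForm (hΨ : Ψ.IsHomogeneous 3) (a b : ℂ)
    (h : ∀ v, MvPolynomial.eval v (standardForm a b) = 0 → MvPolynomial.eval v Ψ = 0) :
    ∃ c, ∀ v, MvPolynomial.eval v Ψ = c * MvPolynomial.eval v (standardForm a b) := by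
  obtain ⟨k, rfl⟩ := exists_eq_ternaryCubic hΨ
  let f : ℂ[X] := X ^ 3 + C a * X + C b
  let A : ℂ[X] := C (k 5) * X ^ 4 + C (k 0 + k 6) * X ^ 3 + C (k 4 + k 5 * a) * X ^ 2
    + C (k 5 * b + k 6 * a + k 7) * X + C (k 6 * b + k 2)
  let B : ℂ[X] := C (k 1) * X ^ 3 + C (k 3) * X ^ 2 + C (k 1 * a + k 9) * X + C (k 1 * b + k 8)
  have key (t y : ℂ) (hy : y ^ 2 = f.eval t) : A.eval t + B.eval t * y = 0 := by
    simp [f] at hy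
    have := h ![t, y, 1] (by simp [eval_standardForm]; linear_combination - hy)
    simp [eval_ternaryCubic] at this
    simp [A, B]
    linear_combination this - (k 5 * t + k 6 + k 1 * y) * hy
  have hf : f ≠ 0 := by
    intro hf
    have := congrArg (fun p => p.coeff 3) hf
    simp [f] at this
  have hA : A = 0 := by
    refine Polynomial.funext fun t => ?_
    obtain ⟨y, hy⟩ := IsAlgClosed.exists_pow_nat_eq (f.eval t) (n := 2) (by norm_num)
    have h1 := key t y hy
    have h2 := key t (-y) (by rw [neg_sq, hy])
    rw [eval_zero]
    linear_combination (h1 + h2) / 2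
  have hB : B = 0 := by
    have : B * f = 0 := by
      refine Polynomial.funext fun t => ?_
      obtain ⟨y, hy⟩ := IsAlgClosed.exists_pow_nat_eq (f.eval t) (n := 2) (by norm_num)
      have h1 := key t y hy
      have h2 := key t (-y) (by rw [neg_sq, hy])
      rw [eval_zero, eval_mul, ← hy]
      linear_combination y * (h1 - h2) / 2
    exact (mul_eq_zero.1 this).resolve_right hf
  have hA' (i) : A.coeff i = 0 := by rw [hA, coeff_zero]
  have hB' (i) : B.coeff i = 0 := by rw [hB, coeff_zero]
  have a0 := hA' 0
  have a1 := hA' 1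
  have a2 := hA' 2
  have a3 := hA' 3
  have a4 := hA' 4
  have b0 := hB' 0
  have b1 := hB' 1
  have b2 := hB' 2
  have b3 := hB' 3
  simp [A, B, coeff_X, coeff_C, -map_add, -map_mul] at a0 a1 a2 a3 a4 b0 b1 b2 b3
  simp only [a4, b3, zero_mul, zero_add, add_zero] at a0 a1 a2 a3 b0 b1
  refine ⟨- k 6, fun v => ?_⟩
  rw [eval_ternaryCubic, eval_standardForm, a4, b3, a2, b0, b1, b2]
  linear_combination v 0 ^ 3 * a3 + v 2 ^ 3 * a0 + v 0 * v 2 ^ 2 * a1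

theorem exists_eval_eq_mul (hΦ : Φ.IsHomogeneous 3) (hs : IsSmooth Φ) (hΨ : Ψ.IsHomogeneous 3)
    (h : ∀ v, MvPolynomial.eval v Φ = 0 → MvPolynomial.eval v Ψ = 0) :
    ∃ c, ∀ v, MvPolynomial.eval v Ψ = c * MvPolynomial.eval v Φ := by
  obtain ⟨v, hv, hflex⟩ := exists_isFlexVector hΦ hs
  obtain ⟨L, a, b, c, hL, -⟩ := exists_standardForm hΦ hs hv hflex
  obtain ⟨Θ, hΘ, hΘL⟩ := exists_pullback hΨ L
  obtain ⟨d, hd⟩ := exists_eval_eq_mul_standardForm hΘ a b fun v hv => by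
    rw [hΘL]
    exact h _ (by rw [LinearEquiv.coe_coe, hL.2, hv, mul_zero])
  refine ⟨d / c, fun v => ?_⟩
  obtain ⟨v, rfl⟩ := L.surjective v
  have := hd v
  rw [hΘL, LinearEquiv.coe_coe] at this
  rw [this, hL.2]
  field_simp [hL.1]

open Projectivization in
theorem exists_isSimilitude_of_image_eq (hΦ : Φ.IsHomogeneous 3) (hs : IsSmooth Φ)
    (hΨ : Ψ.IsHomogeneous 3) (hΨ0 : ∃ v, MvPolynomial.eval v Ψ ≠ 0)
    {g : Equiv.Perm P2} (hg : g ∈ autP2) (himg : g '' curve Φ = curve Ψ) :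
    ∃ L c, projAut L = g ∧ IsSimilitude Ψ Φ L c := by
  obtain ⟨L, rfl⟩ := mem_autP2_iff.1 hg
  obtain ⟨Θ, hΘ, hΘL⟩ := exists_pullback hΨ L
  obtain ⟨c, hc⟩ := exists_eval_eq_mul hΦ hs hΘ fun v hv => by
    rw [hΘL]
    by_cases h0 : v = 0
    · simpa [h0] using eval_smul_of_cubic hΨ 0 0
    · have : projAut L (mk ℂ v h0) ∈ curve Ψ :=
        himg ▸ Set.mem_image_of_mem _ ((mk_mem_curve_iff hΦ h0).2 hv)
      rwa [projAut_mk, mk_mem_curve_iff hΨ] at this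
  have hc' (v) : MvPolynomial.eval (L v) Ψ = c * MvPolynomial.eval v Φ := by
    rw [← hc, hΘL]; rfl
  refine ⟨L, c, rfl, ?_, hc'⟩
  rintro rfl
  obtain ⟨v, hv⟩ := hΨ0
  obtain ⟨v, rfl⟩ := L.surjective v
  exact hv (by rw [hc', zero_mul])

end Proportional

/-- Fixing the flex forces the tangent `z = 0` to be preserved, and the vanishing of the `yz²`,
`xyz` and `x²z` terms then makes `L` diagonal. Comparing `x³` with `y²z` ties the three scales
together through `u`, the ratio of the `y`-scale to the `x`-scale. -/
theorem IsSimilitude.standardForm_eq {a b a' b' c : ℂ} {L : (Fin 3 → ℂ) ≃ₗ[ℂ] (Fin 3 → ℂ)}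
    (h : IsSimilitude (standardForm a b) (standardForm a' b') L c) {r : ℂ}
    (hr : L ![0, 1, 0] = r • ![0, 1, 0]) :
    ∃ s u : ℂ, s ≠ 0 ∧ u ≠ 0 ∧ (∀ v, L v = s • ![u ^ 2 * v 0, u ^ 3 * v 1, v 2]) ∧
      a = u ^ 4 * a' ∧ b = u ^ 6 * b' ∧ c = s ^ 3 * u ^ 6 := by
  have hc := h.1
  have hD (x y) := h.dirDeriv_apply (isHomogeneous_standardForm a b)
    (isHomogeneous_standardForm a' b') x y
  have hE := h.2
  obtain ⟨p, hp⟩ : ∃ p, L ![1, 0, 0] = p := ⟨_, rfl⟩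
  obtain ⟨q, hq⟩ : ∃ q, L ![0, 0, 1] = q := ⟨_, rfl⟩
  have e1 := hD ![0, 1, 0] ![0, 0, 1]
  have e2 := hD ![0, 1, 0] ![1, 0, 0]
  have e3 := hE ![1, 0, 0]
  -- The polar at `x + y` is needed to isolate the `xyz` coefficient, as `e4 - e6 - e1`.
  have e4 := hD (![1, 0, 0] + ![0, 1, 0]) ![0, 0, 1]
  have e5 := hD ![0, 0, 1] ![0, 1, 0]
  have e6 := hD ![1, 0, 0] ![0, 0, 1]
  have e7 := hD ![0, 0, 1] ![1, 0, 0]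
  have e8 := hE ![0, 0, 1]
  rw [map_add] at e4
  rw [hr, hq] at e1
  rw [hr, hp] at e2
  rw [hp] at e3
  rw [hr, hp, hq] at e4
  rw [hr, hq] at e5
  rw [hp, hq] at e6 e7
  rw [hq] at e8
  rw [dirDeriv_standardForm] at e4
  simp only [Pi.add_apply] at e4
  simp [dirDeriv_standardForm, eval_standardForm] at e1 e2 e3 e4 e5 e6 e7 e8
  have hr0 : r ≠ 0 := by rintro rfl; exact hc (by rw [← e1]; ring)
  have hq2 : q 2 ≠ 0 := by intro h; exact hc (by rw [← e1, h]; ring)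
  have hp2 : p 2 = 0 := e2.resolve_left hr0
  have hq1 : q 1 = 0 := by simpa [hr0, hq2] using e5
  simp only [hp2, hq1] at e3 e4 e6 e7 e8
  have e3' : p 0 ^ 3 = c := by linear_combination e3
  have hp0 : p 0 ≠ 0 := by intro h; exact hc (by rw [← e3', h]; ring)
  have hp1 : p 1 = 0 := by
    have : r * q 2 * p 1 = 0 := by linear_combination (e6 - e4 - e1) / 2
    simpa [hr0, hq2] using this
  rw [hp1] at e6 e7
  have hq0 : q 0 = 0 := by
    have : p 0 ^ 2 * q 0 = 0 := by linear_combination e6 / 3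
    simpa [hp0] using this
  rw [hq0] at e7 e8
  obtain ⟨u, hu⟩ : ∃ u, r = u * p 0 := ⟨r / p 0, by field_simp⟩
  have hu0 : u ≠ 0 := by rintro rfl; exact hr0 (by rw [hu, zero_mul])
  have hu2 : p 0 = q 2 * u ^ 2 := by
    refine mul_left_cancel₀ (pow_ne_zero 2 hp0) ?_
    rw [hu] at e1
    linear_combination e3' - e1
  have hu3 : r = q 2 * u ^ 3 := by linear_combination hu + u * hu2
  have hL (v i) : L v i = v 0 * p i + v 1 * (r * ![0, 1, 0] i) + v 2 * q i := by
    have hv : v = v 0 • ![1, 0, 0] + v 1 • ![0, 1, 0] + v 2 • ![0, 0, 1] := by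
      ext i; fin_cases i <;> simp
    conv_lhs => rw [hv]
    rw [map_add, map_add, map_smul, map_smul, map_smul, hp, hq, hr]
    rfl
  have hcu : c = q 2 ^ 3 * u ^ 6 := by rw [← e3', hu2]; ring
  refine ⟨q 2, u, hq2, hu0, fun v => ?_, ?_, ?_, hcu⟩
  · ext i
    rw [hL]
    fin_cases i
    · simp [hq0]; linear_combination v 0 * hu2
    · simp [hp1, hq1]; linear_combination v 1 * hu3
    · simp [hp2]; ring
  · refine mul_left_cancel₀ (mul_ne_zero (pow_ne_zero 3 hq2) (pow_ne_zero 2 hu0)) ?_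
    rw [hcu, hu2] at e7
    linear_combination e7
  · refine mul_left_cancel₀ (pow_ne_zero 3 hq2) ?_
    rw [hcu] at e8
    linear_combination e8

/-! ### Reduction to the Hesse form -/

/-- The Hesse form `x³ + y³ + z³ - 3 t xyz`. -/
noncomputable def hesseForm (t : ℂ) : MvPolynomial (Fin 3) ℂ :=
  ternaryCubic ![1, 1, 1, 0, 0, 0, 0, 0, 0, -3 * t]

theorem isHomogeneous_hesseForm (t : ℂ) : (hesseForm t).IsHomogeneous 3 :=
  isHomogeneous_ternaryCubic _

theorem eval_hesseForm (t : ℂ) (v : Fin 3 → ℂ) : MvPolynomial.eval v (hesseForm t) =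
    v 0 ^ 3 + v 1 ^ 3 + v 2 ^ 3 - 3 * t * v 0 * v 1 * v 2 := by
  rw [hesseForm, eval_ternaryCubic]
  simp [Matrix.cons_val]
  ring

theorem dirDeriv_hesseForm (t : ℂ) (v w : Fin 3 → ℂ) : dirDeriv (hesseForm t) v w =
    3 * (v 0 ^ 2 - t * v 1 * v 2) * w 0 + 3 * (v 1 ^ 2 - t * v 0 * v 2) * w 1
      + 3 * (v 2 ^ 2 - t * v 0 * v 1) * w 2 := by
  rw [hesseForm, dirDeriv_ternaryCubic]
  simp [Matrix.cons_val]
  ring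

theorem eval_hessian_hesseForm (t : ℂ) (v : Fin 3 → ℂ) :
    MvPolynomial.eval v (hessian (hesseForm t)) =
      216 * (1 - t ^ 3) * (v 0 * v 1 * v 2)
        - 54 * t ^ 2 * MvPolynomial.eval v (hesseForm t) := by
  rw [eval_hesseForm, eval_hessian, hesseForm, hessianMatrix_ternaryCubic]
  simp [Matrix.cons_val, Matrix.det_fin_three]
  ring

theorem cube_ne_one_of_isSmooth {t : ℂ} (h : IsSmooth (hesseForm t)) : t ^ 3 ≠ 1 := by
  intro ht
  rw [isSmooth_iff (isHomogeneous_hesseForm t)] at h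
  obtain ⟨w, hw⟩ := h ![1, 1, t ^ 2] (fun h => by simpa using congrFun h 0) (by
    simp [eval_hesseForm]; linear_combination (t ^ 3 - 2) * ht)
  apply hw
  simp [dirDeriv_hesseForm]
  linear_combination (- 3 * w 0 - 3 * w 1 + 3 * t * w 2) * ht

/-- The equations amount to `X³ + aX + b - (m(X - x) + n)² = (X - x)³`: an affine flex `(x, n)`
whose tangent has slope `m`. The quartic for `x` is the 3-division polynomial; `n = 0` would make
`(x, 0)` singular. -/
theorem exists_flex_tangent_of_standardForm {a b : ℂ} (hs : IsSmooth (standardForm a b)) :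
    ∃ x m n : ℂ, n ≠ 0 ∧ m ^ 2 = 3 * x ∧ 2 * m * n = 3 * x ^ 2 + a ∧
      n ^ 2 = x ^ 3 + a * x + b := by
  obtain ⟨x, hx⟩ : ∃ x, 3 * x ^ 4 + 6 * a * x ^ 2 + 12 * b * x - a ^ 2 = 0 := by
    let P : Polynomial ℂ := .C 3 * .X ^ 4 + .C (6 * a) * .X ^ 2 + .C (12 * b) * .X + .C (-a ^ 2)
    have hP : P.degree = 4 := by unfold P; compute_degree!
    obtain ⟨x, hx⟩ := IsAlgClosed.exists_root P (by rw [hP]; decide)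
    refine ⟨x, ?_⟩
    simp [P] at hx
    linear_combination hx
  obtain ⟨n, hn⟩ := IsAlgClosed.exists_pow_nat_eq (x ^ 3 + a * x + b) (n := 2) (by norm_num)
  have hn0 : n ≠ 0 := by
    rintro rfl
    have hx2 : 3 * x ^ 2 + a = 0 := by
      have : (3 * x ^ 2 + a) ^ 2 = 0 := by linear_combination - hx - 12 * x * hn
      simpa using this
    rw [isSmooth_iff (isHomogeneous_standardForm a b)] at hs
    obtain ⟨w, hw⟩ := hs ![x, 0, 1] (fun h => by simpa using congrFun h 2) (by
      simp [eval_standardForm]; linear_combination - hn)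
    apply hw
    simp [dirDeriv_standardForm]
    linear_combination w 0 * hx2 + w 2 * (- 3 * hn - x * hx2)
  refine ⟨x, (3 * x ^ 2 + a) / (2 * n), n, hn0, ?_, by field_simp, hn⟩
  field_simp
  linear_combination - hx - 12 * x * hn

/-- The flexes `(x, n)`, `(x, -n)` and infinity lie on a line `X = 0`. With their tangents suitably
scaled to `A`, `B`, `D`, the curve is `ABD = 2nX³` with `A + B + D = 3sX`. Writing `A, B, D` as `ωⁱ
v₀ + ω²ⁱ v₁ + s v₂` and `X = v₂` turns the product into `v₀³ + v₁³ + s³v₂³ - 3s v₀v₁v₂`; rescaling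
`v₂` finishes. -/
theorem exists_hesseForm_of_standardForm {a b : ℂ} (hs : IsSmooth (standardForm a b)) :
    ∃ L c t, IsSimilitude (standardForm a b) (hesseForm t) L c := by
  obtain ⟨x, m, n, hn, h1, h2, h3⟩ := exists_flex_tangent_of_standardForm hs
  obtain ⟨ω, hω⟩ : ∃ ω : ℂ, ω ^ 2 + ω + 1 = 0 := by
    obtain ⟨d, hd⟩ := IsAlgClosed.exists_pow_nat_eq (-3 : ℂ) (n := 2) (by norm_num)
    exact ⟨(-1 + d) / 2, by linear_combination hd / 4⟩
  obtain ⟨s, rfl⟩ : ∃ s, m = 3 * s / 2 := ⟨2 * m / 3, by ring⟩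
  obtain ⟨k, hk⟩ : ∃ k, 2 * n * k = -1 := ⟨-1 / (2 * n), by field_simp⟩
  have hk0 : k ≠ 0 := by rintro rfl; simp at hk
  have hω' : ω ^ 2 - ω ≠ 0 := by
    intro h
    have : (3 : ℂ) = 0 := by linear_combination 4 * h - (2 * ω - 3) * (hω - h)
    norm_num at this
  have key (A B D X : ℂ) (hsum : A + B + D = 2 * (3 * s / 2) * X) :
      - ((B - 3 * s / 2 * X + D / 2) ^ 2 * (k * D)) + (X + x * (k * D)) ^ 3
        + a * (X + x * (k * D)) * (k * D) ^ 2 + b * (k * D) ^ 3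
        = k * (A * B * D - 2 * n * X ^ 3) := by
    have hz : n * (k * D) = - D / 2 := by linear_combination D / 2 * hk
    linear_combination - X ^ 2 * (k * D) * h1 - X * (k * D) ^ 2 * h2 - (k * D) ^ 3 * h3
      + (k * D) * (2 * (3 * s / 2) * X + n * (k * D) - D / 2) * hz - k * B * D * hsum + X ^ 3 * hk
  obtain ⟨L, hL⟩ := exists_linearEquiv_mulVec
    !![x * k * ω ^ 2, x * k * ω, 1 + x * k * s;
      ω + ω ^ 2 / 2, ω ^ 2 + ω / 2, 0;
      k * ω ^ 2, k * ω, k * s] (by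
    convert mul_ne_zero hk0 hω' using 1
    simp [Matrix.det_fin_three]
    linear_combination (k * (ω - ω ^ 2)) * hω)
  have hsim : IsSimilitude (standardForm a b)
      (ternaryCubic ![1, 1, s ^ 3 - 2 * n, 0, 0, 0, 0, 0, 0, -3 * s]) L k := by
    refine ⟨hk0, fun v => ?_⟩
    have := key (v 0 + v 1 + s * v 2) (ω * v 0 + ω ^ 2 * v 1 + s * v 2)
      (ω ^ 2 * v 0 + ω * v 1 + s * v 2) (v 2)
      (by linear_combination (v 0 + v 1) * hω)
    rw [eval_standardForm, hL, eval_ternaryCubic]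
    simp [Matrix.mulVec, dotProduct, Fin.sum_univ_three, Matrix.cons_val]
    linear_combination this + k * (v 0 + v 1 + s * v 2) *
      ((ω - 1) * (v 0 ^ 2 + v 1 ^ 2) + (ω ^ 2 - ω + 1) * v 0 * v 1
        + (v 0 + v 1) * (s * v 2)) * hω
  have hd : s ^ 3 - 2 * n ≠ 0 := by
    intro hd
    have := hsim.isSmooth (isHomogeneous_standardForm a b) (isHomogeneous_ternaryCubic _) hs
    rw [isSmooth_iff (isHomogeneous_ternaryCubic _)] at this
    obtain ⟨w, hw⟩ := this ![0, 0, 1] (fun h => by simpa using congrFun h 2) (by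
      simp [eval_ternaryCubic, hd])
    apply hw
    simp [dirDeriv_ternaryCubic, hd]
  obtain ⟨r, hr⟩ := IsAlgClosed.exists_pow_nat_eq (s ^ 3 - 2 * n) (n := 3) (by norm_num)
  have hr0 : r ≠ 0 := by rintro rfl; exact hd (by rw [← hr]; ring)
  obtain ⟨M, hM⟩ := exists_linearEquiv_mulVec !![1, 0, 0; 0, 1, 0; 0, 0, 1 / r] (by
    simpa [Matrix.det_fin_three] using hr0)
  refine ⟨L * M, _, s / r, hsim.mul (d := 1) ⟨one_ne_zero, fun v => ?_⟩⟩
  rw [eval_hesseForm, hM, eval_ternaryCubic]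
  simp [Matrix.mulVec, dotProduct, Fin.sum_univ_three, Matrix.cons_val]
  rw [← hr]
  field_simp
  ring

theorem exists_hesseForm (hΦ : Φ.IsHomogeneous 3) (hs : IsSmooth Φ) :
    ∃ L c t, IsSimilitude Φ (hesseForm t) L c ∧ t ^ 3 ≠ 1 := by
  obtain ⟨v, hv, h⟩ := exists_isFlexVector hΦ hs
  obtain ⟨L, a, b, c, hL, -⟩ := exists_standardForm hΦ hs hv h
  obtain ⟨M, d, t, hM⟩ := exists_hesseForm_of_standardForm
    (hL.isSmooth hΦ (isHomogeneous_standardForm a b) hs)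
  exact ⟨L * M, c * d, t, hL.mul hM, cube_ne_one_of_isSmooth
    ((hL.mul hM).isSmooth hΦ (isHomogeneous_hesseForm t) hs)⟩

theorem det_mulVec {L : (Fin 3 → ℂ) ≃ₗ[ℂ] (Fin 3 → ℂ)} {M : Matrix (Fin 3) (Fin 3) ℂ}
    (h : ∀ v, L v = M.mulVec v) : (LinearEquiv.det L : ℂ) = M.det := by
  rw [LinearEquiv.coe_det, ← LinearMap.det_toLin']
  congr 1
  ext v
  simp [h]

/-! ### Automorphisms with a fixed point on the curve -/

section FixedPoint

theorem exists_eval_add_smul_eq_zero (hΦ : Φ.IsHomogeneous 3) {v w : Fin 3 → ℂ}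
    (hw : MvPolynomial.eval w Φ ≠ 0) : ∃ t : ℂ, MvPolynomial.eval (v + t • w) Φ = 0 := by
  let p : Polynomial ℂ := .C (MvPolynomial.eval w Φ) * .X ^ 3 + .C (dirDeriv Φ w v) * .X ^ 2
    + .C (dirDeriv Φ v w) * .X + .C (MvPolynomial.eval v Φ)
  have hp : p.degree = 3 := Polynomial.degree_cubic hw
  obtain ⟨t, ht⟩ := IsAlgClosed.exists_root p (by rw [hp]; decide)
  refine ⟨t, ?_⟩
  have := eval_add_smul hΦ v w 1 t
  rw [one_smul] at this
  rw [this]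
  simp [p] at ht
  linear_combination ht

theorem prod_eq_of_cube_eq {α β γ c : ℂ} (hα : α ^ 3 = c) (hβ : β ^ 3 = c) (hγ : γ ^ 3 = c)
    (hαβ : α ≠ β) (hαγ : α ≠ γ) (hβγ : β ≠ γ) : α * β * γ = c := by
  have h1 : α ^ 2 + α * β + β ^ 2 = 0 := by
    refine mul_left_cancel₀ (sub_ne_zero.2 hαβ) ?_
    linear_combination hα - hβ
  have h2 : α ^ 2 + α * γ + γ ^ 2 = 0 := by
    refine mul_left_cancel₀ (sub_ne_zero.2 hαγ) ?_
    linear_combination hα - hγ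
  have h3 : α + β + γ = 0 := by
    refine mul_left_cancel₀ (sub_ne_zero.2 hβγ) ?_
    linear_combination h1 - h2
  linear_combination hα - α * h1 + α * β * h3

/-- If no eigenvector lies on the curve, every eigenvalue is a cube root of `c`. Three distinct ones
have product `c`, so `det L ≠ c` forces a repeated eigenvalue. A two-dimensional eigenspace is a
line of fixed points and meets the cubic; a Jordan block gives a cubic polynomial with a nonzero
period. -/
theorem exists_eigenvector_on_cubic (hΦ : Φ.IsHomogeneous 3)
    {L : (Fin 3 → ℂ) ≃ₗ[ℂ] (Fin 3 → ℂ)} {c : ℂ} (h : IsSimilitude Φ Φ L c)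
    (hdet : (LinearEquiv.det L : ℂ) ≠ c) :
    ∃ v ≠ 0, MvPolynomial.eval v Φ = 0 ∧ ∃ α : ℂ, L v = α • v := by
  by_contra! hne
  have hcube {α : ℂ} {v : Fin 3 → ℂ} (hv : v ≠ 0) (hLv : L v = α • v) :
      MvPolynomial.eval v Φ ≠ 0 ∧ α ^ 3 = c := by
    have h0 : MvPolynomial.eval v Φ ≠ 0 := fun h0 => hne v hv h0 α hLv
    refine ⟨h0, mul_right_cancel₀ h0 ?_⟩
    rw [← h.2, hLv, eval_smul_of_cubic hΦ]
  let f : Module.End ℂ (Fin 3 → ℂ) := L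
  have hroot {α : ℂ} (hα : α ∈ f.charpoly.roots) : ∃ v ≠ 0, L v = α • v := by
    have h1 : f.HasEigenvalue α := by
      rw [Module.End.hasEigenvalue_iff_isRoot_charpoly]
      exact (Polynomial.mem_roots'.1 hα).2
    obtain ⟨v, hv⟩ := h1.exists_hasEigenvector
    exact ⟨v, hv.2, hv.apply_eq_smul⟩
  have hcard : f.charpoly.roots.card = 3 := by
    rw [IsAlgClosed.card_roots_eq_natDegree, LinearMap.charpoly_natDegree]
    simp
  have hprod : f.det = f.charpoly.roots.prod :=
    Module.End.det_eq_prod_roots_charpoly_of_splits (IsAlgClosed.splits _)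
  obtain ⟨α, β, γ, hr⟩ := Multiset.card_eq_three.1 hcard
  obtain ⟨α, hα⟩ : ∃ α, 2 ≤ f.charpoly.roots.count α := by
    by_contra! hcount
    have hnd : f.charpoly.roots.Nodup := by
      rw [Multiset.nodup_iff_count_le_one]
      exact fun x => Nat.lt_succ_iff.1 (hcount x)
    have hc (x) (hx : x ∈ f.charpoly.roots) : x ^ 3 = c := by
      obtain ⟨v, hv, hLv⟩ := hroot hx
      exact (hcube hv hLv).2
    rw [hr] at hnd hc hprod
    simp at hnd hc hprod
    refine hdet ?_
    rw [LinearEquiv.coe_det]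
    refine Eq.trans hprod ?_
    rw [← mul_assoc]
    exact prod_eq_of_cube_eq hc.1 hc.2.1 hc.2.2 hnd.1.1 hnd.1.2 hnd.2
  -- Semisimplicity at `α`: either `(L - α)² w = 0` always implies `(L - α) w = 0`, or some `w`
  -- spans a Jordan block.
  by_cases hss : ∀ w, L (L w - α • w) = α • (L w - α • w) → L w = α • w
  · have hker : f.maxGenEigenspace α ≤ f.eigenspace α := by
      intro w hw
      obtain ⟨k, hk⟩ := (Module.End.mem_maxGenEigenspace f α w).1 hw
      rw [Module.End.mem_eigenspace_iff]
      have key (k : ℕ) (w) : ((f - α • 1) ^ (k + 1)) w = 0 → f w = α • w := by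
        induction k generalizing w with
        | zero => intro h; simpa [sub_eq_zero] using h
        | succ k ih =>
          intro h
          rw [pow_succ, Module.End.mul_apply] at h
          exact hss w (ih _ h)
      exact key k w (by rw [pow_succ', Module.End.mul_apply, hk, map_zero])
    have hfr : 2 ≤ Module.finrank ℂ (f.eigenspace α) := by
      refine le_trans ?_ (Submodule.finrank_mono hker)
      rw [LinearMap.finrank_maxGenEigenspace_eq, ← Polynomial.count_roots]
      exact hα
    have : Nontrivial (f.eigenspace α) := Module.nontrivial_of_finrank_pos (R := ℂ) (by omega)
    obtain ⟨x, hx⟩ := exists_ne (0 : f.eigenspace α)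
    obtain ⟨y, hxy⟩ := exists_linearIndependent_pair_of_one_lt_finrank (R := ℂ) (by omega) hx
    have heig (z : f.eigenspace α) : L z = α • (z : Fin 3 → ℂ) :=
      Module.End.mem_eigenspace_iff.1 z.2
    have hy : (y : Fin 3 → ℂ) ≠ 0 := by simpa using hxy.ne_zero 1
    obtain ⟨t, ht⟩ := exists_eval_add_smul_eq_zero hΦ (v := (x : Fin 3 → ℂ)) (hcube hy (heig y)).1
    refine hne (x + t • y : f.eigenspace α) ?_ ht α (heig _)
    intro h0
    have := (LinearIndependent.pair_iff.1 hxy 1 t (by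
      rw [one_smul]; exact Subtype.ext h0)).1
    exact one_ne_zero this
  · push Not at hss
    obtain ⟨w, hw, hw'⟩ := hss
    set e := L w - α • w with he
    have he0 : e ≠ 0 := sub_ne_zero.2 hw'
    obtain ⟨h1, h2⟩ := hcube he0 hw
    have hα0 : α ≠ 0 := by rintro rfl; exact h.1 (by rw [← h2]; ring)
    have hstep (t : ℂ) : MvPolynomial.eval ((1 : ℂ) • w + (t + 1 / α) • e) Φ
        = MvPolynomial.eval ((1 : ℂ) • w + t • e) Φ := by
      have h3 : L ((1 : ℂ) • w + t • e) = α • ((1 : ℂ) • w + (t + 1 / α) • e) := by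
        rw [map_add, map_smul, map_smul, hw, show L w = e + α • w by rw [he]; module]
        simp only [smul_add, smul_smul, mul_add, mul_one_div_cancel hα0]
        module
      have h4 := h.2 ((1 : ℂ) • w + t • e)
      rw [h3, eval_smul_of_cubic hΦ, h2] at h4
      exact mul_left_cancel₀ h.1 h4
    -- `Φ(w + t e)` has period `1 / α` in `t`, but its third difference with this step is `6 α⁻³
    -- Φ(e) ≠ 0`.
    have s0 := hstep 0
    have s1 := hstep (1 / α)
    have s2 := hstep (1 / α + 1 / α)
    simp only [eval_add_smul hΦ] at s0 s1 s2
    have h6 : (1 / α) ^ 3 * MvPolynomial.eval e Φ = 0 := by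
      linear_combination (s2 - 2 * s1 + s0) / 6
    simp [hα0, h1] at h6

end FixedPoint

/-! ### Lifts of automorphisms and the group of translations -/

section Group

open Projectivization

theorem exists_eval_ne_zero (hΦ : Φ.IsHomogeneous 3) (hs : IsSmooth Φ) :
    ∃ v, MvPolynomial.eval v Φ ≠ 0 := by
  obtain ⟨L, c, t, hL, -⟩ := exists_hesseForm hΦ hs
  exact ⟨L ![1, 0, 0], by rw [hL.2]; simp [eval_hesseForm, hL.1]⟩

theorem exists_lift (hΦ : Φ.IsHomogeneous 3) (hs : IsSmooth Φ) (g : autCurve (curve Φ)) :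
    ∃ L c, projAut L = g ∧ IsSimilitude Φ Φ L c :=
  exists_isSimilitude_of_image_eq hΦ hs hΦ (exists_eval_ne_zero hΦ hs) g.2.1 g.2.2

theorem IsSimilitude.projAut_mem {L : (Fin 3 → ℂ) ≃ₗ[ℂ] (Fin 3 → ℂ)} {c : ℂ}
    (hΦ : Φ.IsHomogeneous 3) (h : IsSimilitude Φ Φ L c) : projAut L ∈ autCurve (curve Φ) :=
  ⟨⟨L, rfl⟩, h.image_curve hΦ hΦ⟩

theorem smul_mem_flexPoints (hΦ : Φ.IsHomogeneous 3) (hs : IsSmooth Φ) (g : autCurve (curve Φ))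
    {p : P2} (hp : p ∈ flexPoints Φ) : g • p ∈ flexPoints Φ := by
  obtain ⟨L, c, hLg, hL⟩ := exists_lift hΦ hs g
  change (g : Equiv.Perm P2) p ∈ _
  rw [← hLg]
  induction p using Projectivization.ind with
  | _ v hv =>
    rw [projAut_mk, mk_mem_flexPoints_iff hΦ, hL.isFlexVector_iff hΦ hΦ]
    exact (mk_mem_flexPoints_iff hΦ hv).1 hp

/-- The projective automorphisms of `Φ = 0` induced by a linear automorphism `L` whose determinant
equals the factor by which it scales `Φ`. These are the ones acting as translations. -/
noncomputable def translations (Φ : MvPolynomial (Fin 3) ℂ) : Subgroup (autCurve (curve Φ)) where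
  carrier := {g | ∃ L c, projAut L = g ∧ IsSimilitude Φ Φ L c ∧ (LinearEquiv.det L : ℂ) = c}
  one_mem' := ⟨1, 1, by simp, .one Φ, by simp⟩
  mul_mem' := by
    rintro g h ⟨L, c, hLg, hL, hLc⟩ ⟨M, d, hMh, hM, hMd⟩
    exact ⟨L * M, c * d, by rw [map_mul, hLg, hMh]; rfl, hL.mul hM, by simp [hLc, hMd]⟩
  inv_mem' := by
    rintro g ⟨L, c, hLg, hL, hLc⟩
    exact ⟨L⁻¹, c⁻¹, by rw [map_inv, hLg]; rfl, hL.inv, by simp [hLc]⟩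

/-- Conjugating a lift changes neither its determinant nor its multiplier. -/
theorem normal_translations (hΦ : Φ.IsHomogeneous 3) (hs : IsSmooth Φ) :
    (translations Φ).Normal := by
  refine ⟨?_⟩
  rintro n ⟨L, c, hLn, hL, hLc⟩ g
  obtain ⟨M, d, hMg, hM⟩ := exists_lift hΦ hs g
  refine ⟨M * L * M⁻¹, d * c * d⁻¹, ?_, (hM.mul hL).mul hM.inv, ?_⟩
  · rw [map_mul, map_mul, map_inv, hMg, hLn]; rfl
  · have := hM.1
    simp [hLc]
    field_simp

theorem exists_fixed_point_of_notMem_translations (hΦ : Φ.IsHomogeneous 3) (hs : IsSmooth Φ)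
    {g : autCurve (curve Φ)} (hg : g ∉ translations Φ) : ∃ p ∈ curve Φ, g • p = p := by
  obtain ⟨L, c, hLg, hL⟩ := exists_lift hΦ hs g
  obtain ⟨v, hv, h0, α, hα⟩ := exists_eigenvector_on_cubic hΦ hL fun h =>
    hg ⟨L, c, hLg, hL, h⟩
  refine ⟨mk ℂ v hv, (mk_mem_curve_iff hΦ hv).2 h0, ?_⟩
  change (g : Equiv.Perm P2) _ = _
  rw [← hLg, projAut_mk_eq_iff]
  exact ⟨α, hα⟩

/-! ### The stabilizer of a flex -/

section Stabilizer

theorem exists_normalForm_of_flex (hΦ : Φ.IsHomogeneous 3) (hs : IsSmooth Φ) {p : P2}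
    (hp : p ∈ flexPoints Φ) : ∃ (L : (Fin 3 → ℂ) ≃ₗ[ℂ] (Fin 3 → ℂ)) (a b c : ℂ),
      IsSimilitude Φ (standardForm a b) L c ∧ 4 * a ^ 3 + 27 * b ^ 2 ≠ 0 ∧
        projAut L (mk ℂ ![0, 1, 0] (fun h => one_ne_zero (congrFun h 1))) = p := by
  induction p using Projectivization.ind with
  | _ v hv =>
    obtain ⟨L, a, b, c, hL, hLv⟩ := exists_standardForm hΦ hs hv
      ((mk_mem_flexPoints_iff hΦ hv).1 hp)
    refine ⟨L, a, b, c, hL, discriminant_ne_zero_of_isSmooth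
      (hL.isSmooth hΦ (isHomogeneous_standardForm a b) hs), ?_⟩
    rw [projAut_mk_eq_iff]
    exact ⟨1, by rw [hLv, one_smul]⟩

/-- The linear automorphism `(x, y, z) ↦ (u² x, u³ y, z)`. -/
noncomputable def weightedDiag : ℂˣ →* ((Fin 3 → ℂ) ≃ₗ[ℂ] (Fin 3 → ℂ)) where
  toFun u :=
    { toFun v := ![u ^ 2 * v 0, u ^ 3 * v 1, v 2]
      map_add' v w := by ext i; fin_cases i <;> simp [mul_add]
      map_smul' s v := by ext i; fin_cases i <;> simp [mul_left_comm]
      invFun v := ![(u⁻¹ : ℂˣ) ^ 2 * v 0, (u⁻¹ : ℂˣ) ^ 3 * v 1, v 2]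
      left_inv v := by ext i; fin_cases i <;> simp
      right_inv v := by ext i; fin_cases i <;> simp }
  map_one' := by ext v i; fin_cases i <;> simp
  map_mul' u w := by ext v i; fin_cases i <;> simp [mul_pow, mul_assoc]

theorem weightedDiag_apply (u : ℂˣ) (v : Fin 3 → ℂ) :
    weightedDiag u v = ![u ^ 2 * v 0, u ^ 3 * v 1, v 2] := rfl

theorem isSimilitude_weightedDiag {a b : ℂ} (u : ℂˣ) (ha : (u : ℂ) ^ 4 * a = a)
    (hb : (u : ℂ) ^ 6 * b = b) :
    IsSimilitude (standardForm a b) (standardForm a b) (weightedDiag u) (u ^ 6) := by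
  refine ⟨pow_ne_zero 6 u.ne_zero, fun v => ?_⟩
  rw [eval_standardForm, eval_standardForm, weightedDiag_apply]
  simp
  linear_combination - u ^ 2 * v 0 * v 2 ^ 2 * ha - v 2 ^ 3 * hb

theorem projAut_weightedDiag_injective :
    Function.Injective fun u => projAut (weightedDiag u) := by
  change Function.Injective (projAut.comp weightedDiag)
  rw [injective_iff_map_eq_one]
  intro u hu
  obtain ⟨s, hs⟩ := (projAut_eq_one_iff (L := weightedDiag u)).1 hu
  have h0 := congrFun (hs ![1, 1, 1]) 0
  have h1 := congrFun (hs ![1, 1, 1]) 1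
  have h2 := congrFun (hs ![1, 1, 1]) 2
  simp [weightedDiag_apply] at h0 h1 h2
  rw [← h2] at h0 h1
  ext
  rw [Units.val_one]
  linear_combination h1 - u * h0

/-- The multiplier and the determinant of a lift fixing a flex differ exactly by the factor `u`, so
equality of the two forces `u = 1`. -/
theorem IsSimilitude.conj_eq {a b c c₀ : ℂ} {L L₀ : (Fin 3 → ℂ) ≃ₗ[ℂ] (Fin 3 → ℂ)}
    (h₀ : IsSimilitude Φ (standardForm a b) L₀ c₀) (h : IsSimilitude Φ Φ L c)
    (hfix : projAut L (projAut L₀ (mk ℂ ![0, 1, 0] (fun h => one_ne_zero (congrFun h 1)))) =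
      projAut L₀ (mk ℂ ![0, 1, 0] (fun h => one_ne_zero (congrFun h 1)))) :
    ∃ (s : ℂ) (u : ℂˣ), s ≠ 0 ∧ (∀ v, (L₀⁻¹ * L * L₀) v = s • weightedDiag u v) ∧
      (u : ℂ) ^ 4 * a = a ∧ (u : ℂ) ^ 6 * b = b ∧ c = s ^ 3 * u ^ 6 ∧
      (LinearEquiv.det L : ℂ) = s ^ 3 * u ^ 5 := by
  have hM := (h₀.inv.mul h).mul h₀
  have hr : ∃ r : ℂ, (L₀⁻¹ * L * L₀) ![0, 1, 0] = r • ![0, 1, 0] := by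
    rw [← projAut_mk_eq_iff (fun h => one_ne_zero (congrFun h 1))
      (fun h => one_ne_zero (congrFun h 1)), map_mul, map_mul, Equiv.Perm.mul_apply,
      Equiv.Perm.mul_apply, hfix, map_inv, ← Equiv.Perm.mul_apply,
      inv_mul_cancel, Equiv.Perm.one_apply]
  obtain ⟨r, hr⟩ := hr
  obtain ⟨s, u, hs0, hu0, hLu, ha, hb, hc⟩ := hM.standardForm_eq hr
  refine ⟨s, Units.mk0 u hu0, hs0, hLu, ha.symm, hb.symm, ?_, ?_⟩
  · rw [← mul_inv_cancel_left₀ h₀.1 c]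
    simp only [Units.val_mk0]
    rw [← hc]; ring
  · have h1 : LinearEquiv.det L = LinearEquiv.det (L₀⁻¹ * L * L₀) := by
      simp [mul_comm]
    rw [h1, det_mulVec (M := !![s * u ^ 2, 0, 0; 0, s * u ^ 3, 0; 0, 0, s])]
    · simp [Matrix.det_fin_three]; ring
    · intro v
      rw [hLu]
      ext i
      fin_cases i <;> simp [Matrix.mulVec, dotProduct, Fin.sum_univ_three, mul_assoc]

theorem eq_one_of_mem_translations_of_smul_eq (hΦ : Φ.IsHomogeneous 3) (hs : IsSmooth Φ)
    {g : autCurve (curve Φ)} (hg : g ∈ translations Φ) {p : P2} (hp : p ∈ flexPoints Φ)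
    (hgp : g • p = p) : g = 1 := by
  obtain ⟨L, c, hLg, hL, hLc⟩ := hg
  obtain ⟨L₀, a, b, c₀, h₀, -, rfl⟩ := exists_normalForm_of_flex hΦ hs hp
  obtain ⟨s, u, hs0, hLu, -, -, hc, hdet⟩ := h₀.conj_eq hL (by rw [hLg]; exact hgp)
  have hu : u = 1 := by
    ext
    rw [hLc, hc] at hdet
    refine mul_left_cancel₀ (mul_ne_zero (pow_ne_zero 3 hs0) (pow_ne_zero 5 u.ne_zero)) ?_
    rw [Units.val_one]
    linear_combination hdet
  have h1 : projAut (L₀⁻¹ * L * L₀) = 1 :=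
    projAut_eq_one_iff.2 ⟨s, fun v => by rw [hLu, hu, map_one]; rfl⟩
  have h2 : projAut L = 1 := by
    rw [map_mul, map_mul, map_inv] at h1
    calc projAut L = projAut L₀ * ((projAut L₀)⁻¹ * projAut L * projAut L₀) * (projAut L₀)⁻¹ := by
          group
      _ = 1 := by rw [h1]; group
  exact Subtype.ext (hLg.symm.trans h2)

/-- Conjugation by `L₀` carries the maps `diag(u², u³, 1)` with `uⁿ = 1` bijectively onto the
stabilizer, which is thus a copy of `rootsOfUnity n ℂ`. -/
theorem stabilizer_of_standardForm (hΦ : Φ.IsHomogeneous 3) (hs : IsSmooth Φ) {a b c₀ : ℂ}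
    {L₀ : (Fin 3 → ℂ) ≃ₗ[ℂ] (Fin 3 → ℂ)} (h₀ : IsSimilitude Φ (standardForm a b) L₀ c₀)
    {p : P2} (hp : projAut L₀ (mk ℂ ![0, 1, 0] (fun h => one_ne_zero (congrFun h 1))) = p)
    (n : ℕ) [NeZero n] (hn : ∀ u : ℂˣ, ((u : ℂ) ^ 4 * a = a ∧ (u : ℂ) ^ 6 * b = b) ↔ u ^ n = 1) :
    IsCyclic (MulAction.stabilizer (autCurve (curve Φ)) p) ∧
      Nat.card (MulAction.stabilizer (autCurve (curve Φ)) p) = n := by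
  let ρ : ℂˣ →* Equiv.Perm P2 := projAut.comp ((MulAut.conj L₀).toMonoidHom.comp weightedDiag)
  have hρ (u : ℂˣ) : ρ u = projAut L₀ * projAut (weightedDiag u) * (projAut L₀)⁻¹ := by
    simp [ρ]
  have hρG (u : rootsOfUnity n ℂ) : (ρ.comp (rootsOfUnity n ℂ).subtype) u ∈ autCurve (curve Φ) := by
    obtain ⟨ha, hb⟩ := (hn u).2 ((mem_rootsOfUnity _ _).1 u.2)
    exact ((h₀.mul (isSimilitude_weightedDiag (u : ℂˣ) ha hb)).mul h₀.inv).projAut_mem hΦ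
  let ρ' := (ρ.comp (rootsOfUnity n ℂ).subtype).codRestrict _ hρG
  have hρS (u : rootsOfUnity n ℂ) : ρ' u ∈ MulAction.stabilizer (autCurve (curve Φ)) p := by
    rw [MulAction.mem_stabilizer_iff]
    change ρ u p = p
    rw [hρ, ← hp, ← Equiv.Perm.mul_apply, inv_mul_cancel_right, Equiv.Perm.mul_apply]
    congr 1
    rw [projAut_mk_eq_iff]
    exact ⟨((u : ℂˣ) : ℂ) ^ 3, by rw [weightedDiag_apply]; ext i; fin_cases i <;> simp⟩
  let ρ'' := ρ'.codRestrict _ hρS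
  have hinj : Function.Injective ρ'' := by
    intro u w huw
    have h1 : ρ u = ρ w := congrArg
      (fun x : MulAction.stabilizer (autCurve (curve Φ)) p => (x.1 : Equiv.Perm P2)) huw
    rw [hρ, hρ, mul_left_inj, mul_right_inj] at h1
    exact Subtype.ext (projAut_weightedDiag_injective h1)
  have hsurj : Function.Surjective ρ'' := by
    rintro ⟨g, hg⟩
    obtain ⟨L, c, hLg, hL⟩ := exists_lift hΦ hs g
    obtain ⟨s, u, hs0, hLu, ha, hb, -, -⟩ := h₀.conj_eq hL (by rw [hLg, hp]; exact hg)
    refine ⟨⟨u, (mem_rootsOfUnity _ _).2 ((hn u).1 ⟨ha, hb⟩)⟩, Subtype.ext (Subtype.ext ?_)⟩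
    change ρ u = g
    have h1 : projAut (L₀⁻¹ * L * L₀ * (weightedDiag u)⁻¹) = 1 := by
      refine projAut_eq_one_iff.2 ⟨s, fun v => ?_⟩
      rw [LinearEquiv.mul_apply, hLu, ← LinearEquiv.mul_apply, mul_inv_cancel]
      rfl
    rw [map_mul, map_inv, mul_inv_eq_one] at h1
    rw [hρ, ← h1, ← hLg, map_mul, map_mul, map_inv]
    group
  refine ⟨isCyclic_of_surjective ρ'' hsurj, ?_⟩
  rw [← Nat.card_congr (Equiv.ofBijective ρ'' ⟨hinj, hsurj⟩),
    Complex.card_rootsOfUnity]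

end Stabilizer

end Group

/-! ### Flexes and translations of the Hesse form -/

section Hesse

open Projectivization

/-- The linear automorphism `(x, y, z) ↦ (y, z, x)`. -/
noncomputable def cyclicShift : (Fin 3 → ℂ) ≃ₗ[ℂ] (Fin 3 → ℂ) where
  toFun v := ![v 1, v 2, v 0]
  map_add' v w := by ext i; fin_cases i <;> simp
  map_smul' s v := by ext i; fin_cases i <;> simp
  invFun v := ![v 2, v 0, v 1]
  left_inv v := by ext i; fin_cases i <;> simp
  right_inv v := by ext i; fin_cases i <;> simp

theorem cyclicShift_apply (v : Fin 3 → ℂ) : cyclicShift v = ![v 1, v 2, v 0] := rfl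

/-- The linear automorphism `(x, y, z) ↦ (x, u y, u² z)`. -/
noncomputable def clockDiag : ℂˣ →* ((Fin 3 → ℂ) ≃ₗ[ℂ] (Fin 3 → ℂ)) where
  toFun u :=
    { toFun v := ![v 0, u * v 1, u ^ 2 * v 2]
      map_add' v w := by ext i; fin_cases i <;> simp [mul_add]
      map_smul' s v := by ext i; fin_cases i <;> simp [mul_left_comm]
      invFun v := ![v 0, (u⁻¹ : ℂˣ) * v 1, (u⁻¹ : ℂˣ) ^ 2 * v 2]
      left_inv v := by ext i; fin_cases i <;> simp
      right_inv v := by ext i; fin_cases i <;> simp }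
  map_one' := by ext v i; fin_cases i <;> simp
  map_mul' u w := by ext v i; fin_cases i <;> simp [mul_pow, mul_assoc]

theorem clockDiag_apply (u : ℂˣ) (v : Fin 3 → ℂ) :
    clockDiag u v = ![v 0, u * v 1, u ^ 2 * v 2] := rfl

theorem cyclicShift_pow_three : cyclicShift ^ 3 = 1 := by
  ext v i
  simp only [pow_succ, pow_zero, one_mul, LinearEquiv.mul_apply]
  fin_cases i <;> simp [cyclicShift_apply]

theorem isSimilitude_cyclicShift (t : ℂ) :
    IsSimilitude (hesseForm t) (hesseForm t) cyclicShift 1 := by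
  refine ⟨one_ne_zero, fun v => ?_⟩
  rw [eval_hesseForm, eval_hesseForm, cyclicShift_apply]
  simp
  ring

theorem isSimilitude_clockDiag (t : ℂ) {u : ℂˣ} (hu : u ^ 3 = 1) :
    IsSimilitude (hesseForm t) (hesseForm t) (clockDiag u) 1 := by
  have hu' : (u : ℂ) ^ 3 = 1 := by
    rw [← Units.val_pow_eq_pow_val, hu, Units.val_one]
  refine ⟨one_ne_zero, fun v => ?_⟩
  rw [eval_hesseForm, eval_hesseForm, clockDiag_apply]
  simp
  linear_combination (v 1 ^ 3 + (u ^ 3 + 1) * v 2 ^ 3 - 3 * t * v 0 * v 1 * v 2) * hu'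

theorem det_cyclicShift : (LinearEquiv.det cyclicShift : ℂ) = 1 := by
  rw [det_mulVec (M := !![0, 1, 0; 0, 0, 1; 1, 0, 0])]
  · simp [Matrix.det_fin_three]
  · intro v
    ext i
    fin_cases i <;> simp [cyclicShift_apply, Matrix.mulVec, dotProduct, Fin.sum_univ_three]

theorem det_clockDiag (u : ℂˣ) : (LinearEquiv.det (clockDiag u) : ℂ) = u ^ 3 := by
  rw [det_mulVec (M := !![1, 0, 0; 0, (u : ℂ), 0; 0, 0, (u : ℂ) ^ 2])]
  · simp [Matrix.det_fin_three]; ring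
  · intro v
    ext i
    fin_cases i <;> simp [clockDiag_apply, Matrix.mulVec, dotProduct, Fin.sum_univ_three]

/-- The eigenvalues `1, u, u²` are distinct, so the eigenvectors lie on the coordinate axes, off the
curve. -/
theorem clockDiag_fixed_free {t : ℂ} {u : ℂˣ} (hu : u ^ 3 = 1) (hu1 : u ≠ 1)
    {v : Fin 3 → ℂ} (hv : v ≠ 0) (h0 : MvPolynomial.eval v (hesseForm t) = 0) (r : ℂ) :
    clockDiag u v ≠ r • v := by
  intro h
  have h1 : (1 - r) * v 0 = 0 := by
    have := congrFun h 0
    simp [clockDiag_apply] at this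
    linear_combination this
  have h2 : (u - r) * v 1 = 0 := by
    have := congrFun h 1
    simp [clockDiag_apply, -mul_eq_mul_right_iff] at this
    linear_combination this
  have h3 : (u ^ 2 - r) * v 2 = 0 := by
    have := congrFun h 2
    simp [clockDiag_apply, -mul_eq_mul_right_iff] at this
    linear_combination this
  have hu' : (u : ℂ) ^ 3 = 1 := by
    rw [← Units.val_pow_eq_pow_val, hu, Units.val_one]
  have hu1' : (u : ℂ) - 1 ≠ 0 := sub_ne_zero.2 fun h => hu1 (Units.ext h)
  have n12 : v 0 * v 1 = 0 := by
    have : (u - 1 : ℂ) * (v 0 * v 1) = 0 := by linear_combination v 0 * h2 - v 1 * h1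
    simpa [hu1'] using this
  have n23 : v 1 * v 2 = 0 := by
    have : u * (u - 1 : ℂ) * (v 1 * v 2) = 0 := by linear_combination v 1 * h3 - v 2 * h2
    simpa [hu1', u.ne_zero] using this
  have n13 : v 0 * v 2 = 0 := by
    have : u ^ 2 * (u - 1 : ℂ) * (v 0 * v 2) = 0 := by
      linear_combination v 2 * h1 - v 0 * h3 + v 0 * v 2 * hu'
    simpa [hu1', u.ne_zero] using this
  rw [eval_hesseForm] at h0
  apply hv
  have e0 : v 0 = 0 := by
    have : v 0 ^ 4 = 0 := by
      linear_combination v 0 * h0 - v 1 ^ 2 * n12 - v 2 ^ 2 * n13 + 3 * t * v 0 * v 2 * n12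
    simpa using this
  have e1 : v 1 = 0 := by
    have : v 1 ^ 4 = 0 := by
      linear_combination v 1 * h0 - v 0 ^ 2 * n12 - v 2 ^ 2 * n23 + 3 * t * v 1 * v 2 * n12
    simpa using this
  have e2 : v 2 = 0 := by
    have : v 2 ^ 4 = 0 := by
      linear_combination v 2 * h0 - v 0 ^ 2 * n13 - v 1 ^ 2 * n23 + 3 * t * v 2 * v 2 * n12
    simpa using this
  ext i
  fin_cases i <;> assumption

/-- An eigenvector is proportional to `(r, u² r², 1)` with `r³ = 1`, where the form takes the value
`3 - 3 t u²`; vanishing would give `t³ = 1`. -/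
theorem cyclicShift_fixed_free {t : ℂ} (ht : t ^ 3 ≠ 1) {u : ℂˣ} (hu : u ^ 3 = 1)
    {v : Fin 3 → ℂ} (hv : v ≠ 0) (h0 : MvPolynomial.eval v (hesseForm t) = 0) (r : ℂ) :
    cyclicShift (clockDiag u v) ≠ r • v := by
  intro h
  have h1 : u * v 1 = r * v 0 := by simpa [cyclicShift_apply, clockDiag_apply] using congrFun h 0
  have h2 : u ^ 2 * v 2 = r * v 1 := by
    simpa [cyclicShift_apply, clockDiag_apply] using congrFun h 1
  have h3 : v 0 = r * v 2 := by simpa [cyclicShift_apply, clockDiag_apply] using congrFun h 2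
  have hu' : (u : ℂ) ^ 3 = 1 := by
    rw [← Units.val_pow_eq_pow_val, hu, Units.val_one]
  have h4 : v 1 = u ^ 2 * r ^ 2 * v 2 := by
    linear_combination u ^ 2 * h1 - v 1 * hu' + u ^ 2 * r * h3
  have hz : v 2 ≠ 0 := by
    intro hz
    rw [hz, mul_zero] at h3 h4
    exact hv (by ext i; fin_cases i <;> assumption)
  have hr : r ^ 3 = 1 := by
    refine mul_right_cancel₀ (mul_ne_zero (pow_ne_zero 2 u.ne_zero) hz) ?_
    linear_combination - h2 - r * h4
  rw [eval_hesseForm, h4, h3] at h0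
  have h5 : t * u ^ 2 = 1 := by
    refine mul_left_cancel₀ (mul_ne_zero three_ne_zero (pow_ne_zero 3 hz)) ?_
    have hu6 : (u : ℂ) ^ 6 = 1 := by linear_combination (u ^ 3 + 1) * hu'
    have hr6 : r ^ 6 = 1 := by linear_combination (r ^ 3 + 1) * hr
    linear_combination - h0 + v 2 ^ 3 * hr + v 2 ^ 3 * r ^ 6 * hu6 + v 2 ^ 3 * hr6
      - 3 * t * u ^ 2 * v 2 ^ 3 * hr
  apply ht
  linear_combination ((t * u ^ 2) ^ 2 + t * u ^ 2 + 1) * h5 - t ^ 3 * (u ^ 3 + 1) * hu'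

/-- On the curve the Hessian reduces to a multiple of `xyz`, nonzero because `t³ ≠ 1`. -/
theorem isFlexVector_hesseForm_iff {t : ℂ} (hs : IsSmooth (hesseForm t)) {v : Fin 3 → ℂ}
    (hv : v ≠ 0) : IsFlexVector (hesseForm t) v ↔
      MvPolynomial.eval v (hesseForm t) = 0 ∧ v 0 * v 1 * v 2 = 0 := by
  have hH := isHomogeneous_hesseForm t
  have ht := cube_ne_one_of_isSmooth hs
  constructor
  · intro h
    have h1 := eval_hessian_of_isFlexVector hH hv h
    rw [eval_hessian_hesseForm, h.1, mul_zero, sub_zero] at h1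
    exact ⟨h.1, (mul_eq_zero.1 h1).resolve_left
      (mul_ne_zero (by norm_num) (sub_ne_zero.2 ht.symm))⟩
  · rintro ⟨h0, h1⟩
    refine isFlexVector_of_eval_hessian hH h0 ((isSmooth_iff hH).1 hs v hv h0) ?_
    rw [eval_hessian_hesseForm, h0, h1]
    ring

theorem exists_isPrimitiveRoot_units : ∃ ω : ℂˣ, IsPrimitiveRoot ω 3 := by
  have h := Complex.isPrimitiveRoot_exp 3 (by norm_num)
  exact ⟨Units.mk0 _ (h.ne_zero (by norm_num)), IsPrimitiveRoot.coe_units_iff.1 h⟩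

theorem exists_clockDiag_of_flex {t : ℂ} {ω : ℂˣ} (hω : IsPrimitiveRoot ω 3) {v : Fin 3 → ℂ}
    (hv : v ≠ 0) (h0 : MvPolynomial.eval v (hesseForm t) = 0) (hv0 : v 0 = 0) :
    ∃ j < 3, projAut (clockDiag (ω ^ j))
      (mk ℂ ![0, 1, -1] (fun h => one_ne_zero (congrFun h 1))) = mk ℂ v hv := by
  rw [eval_hesseForm, hv0] at h0
  have h1 : v 1 ≠ 0 := by
    intro h1
    have h2 : v 2 = 0 := by
      have : v 2 ^ 3 = 0 := by rw [h1] at h0; linear_combination h0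
      simpa using this
    exact hv (by ext i; fin_cases i <;> assumption)
  have hζ : (- v 2 / v 1) ^ 3 = 1 := by
    field_simp
    linear_combination - h0
  obtain ⟨j, hj, hj'⟩ := (IsPrimitiveRoot.coe_units_iff.2 hω).eq_pow_of_pow_eq_one hζ
  refine ⟨j, hj, ?_⟩
  have h2 : v 2 = - (ω ^ j * v 1) := by rw [hj']; field_simp
  rw [projAut_mk_eq_iff]
  refine ⟨ω ^ j / v 1, ?_⟩
  ext i
  fin_cases i
  · simp [clockDiag_apply, hv0, -map_pow]
  · simp [clockDiag_apply, h1, -map_pow]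
  · simp [clockDiag_apply, h2, -map_pow]
    field_simp

theorem exists_cyclicShift_clockDiag_of_flex {t : ℂ} {ω : ℂˣ} (hω : IsPrimitiveRoot ω 3)
    {v : Fin 3 → ℂ} (hv : v ≠ 0) (h0 : MvPolynomial.eval v (hesseForm t) = 0)
    (hprod : v 0 * v 1 * v 2 = 0) :
    ∃ i < 3, ∃ j < 3, projAut (cyclicShift ^ i * clockDiag ω ^ j)
      (mk ℂ ![0, 1, -1] (fun h => one_ne_zero (congrFun h 1))) = mk ℂ v hv := by
  have hS := isSimilitude_cyclicShift t
  have key (i : ℕ) (hi : i < 3) (h : (cyclicShift ^ (3 - i)) v 0 = 0) :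
      ∃ i < 3, ∃ j < 3, projAut (cyclicShift ^ i * clockDiag ω ^ j)
        (mk ℂ ![0, 1, -1] (fun h => one_ne_zero (congrFun h 1))) = mk ℂ v hv := by
    have hpow (n : ℕ) (w) : MvPolynomial.eval ((cyclicShift ^ n) w) (hesseForm t)
        = MvPolynomial.eval w (hesseForm t) := by
      induction n with
      | zero => rfl
      | succ n ih => rw [pow_succ', LinearEquiv.mul_apply, hS.2, ih, one_mul]
    obtain ⟨j, hj, hj'⟩ := exists_clockDiag_of_flex hω (v := (cyclicShift ^ (3 - i)) v)
      (by simpa using hv) ((hpow _ _).trans h0) h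
    refine ⟨i, hi, j, hj, ?_⟩
    rw [map_mul, ← map_pow, Equiv.Perm.mul_apply, hj', projAut_mk_eq_iff]
    refine ⟨1, ?_⟩
    rw [← LinearEquiv.mul_apply, ← pow_add, one_smul, show i + (3 - i) = 3 by omega,
      cyclicShift_pow_three]
    rfl
  rw [mul_eq_zero, mul_eq_zero] at hprod
  obtain (h | h) | h := hprod
  · exact key 0 (by norm_num) (by rw [Nat.sub_zero, cyclicShift_pow_three]; exact h)
  · exact key 2 (by norm_num) (by rw [show 3 - 2 = 1 from rfl, pow_one]; exact h)
  · exact key 1 (by norm_num) (by rw [show 3 - 1 = 2 from rfl, pow_two]; exact h)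

/-- The four vectors represent flexes of every Hesse form, no three of them collinear; their linear
relation forces the eigenvalues to agree. -/
theorem exists_eq_smul_of_eigenvectors {ω : ℂ} (hω : ω ≠ 1)
    (f : (Fin 3 → ℂ) →ₗ[ℂ] (Fin 3 → ℂ)) (h1 : ∃ r : ℂ, f ![0, 1, -1] = r • ![0, 1, -1])
    (h2 : ∃ r : ℂ, f ![0, 1, -ω] = r • ![0, 1, -ω])
    (h3 : ∃ r : ℂ, f ![1, 0, -1] = r • ![1, 0, -1])
    (h4 : ∃ r : ℂ, f ![1, 0, -ω] = r • ![1, 0, -ω]) : ∃ r : ℂ, ∀ v, f v = r • v := by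
  obtain ⟨r₁, h1⟩ := h1
  obtain ⟨r₂, h2⟩ := h2
  obtain ⟨r₃, h3⟩ := h3
  obtain ⟨r₄, h4⟩ := h4
  have hω' : ω - 1 ≠ 0 := sub_ne_zero.2 hω
  have hrel : f ![0, 1, -1] - f ![0, 1, -ω] = f ![1, 0, -1] - f ![1, 0, -ω] := by
    rw [← map_sub, ← map_sub]
    congr 1
    ext i; fin_cases i <;> simp
  rw [h1, h2, h3, h4] at hrel
  have e0 := congrFun hrel 0
  have e1 := congrFun hrel 1
  have e2 := congrFun hrel 2
  simp at e0 e1 e2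
  have e12 : r₂ = r₁ := by linear_combination - e1
  have e34 : r₄ = r₃ := by linear_combination e0
  have e13 : r₃ = r₁ := by
    refine mul_left_cancel₀ hω' ?_
    rw [e12, e34] at e2
    linear_combination - e2
  refine ⟨r₁, fun v => ?_⟩
  have hv : v = v 0 • ![1, 0, -1] + v 1 • ![0, 1, -1]
      + ((v 0 + v 1 + v 2) / (ω - 1)) • (![0, 1, -1] - ![0, 1, -ω]) := by
    ext i
    fin_cases i
    · simp
    · simp
    · simp; field_simp; ring
  conv_lhs => rw [hv]
  conv_rhs => rw [hv]
  rw [map_add, map_add, map_smul, map_smul, map_smul, map_sub, h1, h2, h3, e12, e13]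
  module

theorem eq_one_of_forall_flexPoints (hΦ : Φ.IsHomogeneous 3) (hs : IsSmooth Φ)
    {g : autCurve (curve Φ)} (hg : ∀ p ∈ flexPoints Φ, g • p = p) : g = 1 := by
  obtain ⟨L, c, t, hL, ht⟩ := exists_hesseForm hΦ hs
  have hH := isHomogeneous_hesseForm t
  have hsH := hL.isSmooth hΦ hH hs
  obtain ⟨M, d, hMg, hM⟩ := exists_lift hΦ hs g
  obtain ⟨ω, hω⟩ := exists_isPrimitiveRoot_units
  have hω1 : (ω : ℂ) ≠ 1 := fun h => hω.ne_one (by norm_num) (Units.ext h)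
  have hω3 : (ω : ℂ) ^ 3 = 1 := by
    rw [← Units.val_pow_eq_pow_val, hω.pow_eq_one, Units.val_one]
  have key (v : Fin 3 → ℂ) (hv : v ≠ 0) (h0 : MvPolynomial.eval v (hesseForm t) = 0)
      (h1 : v 0 * v 1 * v 2 = 0) : ∃ r : ℂ, (L⁻¹ * M * L) v = r • v := by
    have hLv : L v ≠ 0 := by simpa using hv
    have hflex : mk ℂ (L v) hLv ∈ flexPoints Φ := by
      rw [mk_mem_flexPoints_iff hΦ, hL.isFlexVector_iff hΦ hH,
        isFlexVector_hesseForm_iff hsH hv]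
      exact ⟨h0, h1⟩
    have h2 := hg _ hflex
    change (g : Equiv.Perm P2) _ = _ at h2
    rw [← hMg, projAut_mk_eq_iff] at h2
    obtain ⟨r, hr⟩ := h2
    refine ⟨r, ?_⟩
    rw [LinearEquiv.mul_apply, LinearEquiv.mul_apply, hr, map_smul, ← LinearEquiv.mul_apply,
      inv_mul_cancel]
    rfl
  obtain ⟨r, hr⟩ := exists_eq_smul_of_eigenvectors hω1
    ((L⁻¹ * M * L : (Fin 3 → ℂ) ≃ₗ[ℂ] (Fin 3 → ℂ)) : (Fin 3 → ℂ) →ₗ[ℂ] (Fin 3 → ℂ))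
    (key _ (fun h => one_ne_zero (congrFun h 1)) (by simp [eval_hesseForm]; ring) (by simp))
    (key _ (fun h => one_ne_zero (congrFun h 1))
      (by simp [eval_hesseForm]; linear_combination - hω3) (by simp))
    (key _ (fun h => one_ne_zero (congrFun h 0)) (by simp [eval_hesseForm]; ring) (by simp))
    (key _ (fun h => one_ne_zero (congrFun h 0))
      (by simp [eval_hesseForm]; linear_combination - hω3) (by simp))
  have h1 : projAut (L⁻¹ * M * L) = 1 := projAut_eq_one_iff.2 ⟨r, hr⟩
  rw [map_mul, map_mul, map_inv, mul_eq_one_iff_eq_inv] at h1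
  refine Subtype.ext (hMg.symm.trans ?_)
  simpa using h1

/-- `P` and `Q` are the cyclic shift and `diag(1, ω, ω²)`, transported to `Φ`. Both have determinant
and multiplier one. -/
theorem exists_translation_generators (hΦ : Φ.IsHomogeneous 3) (hs : IsSmooth Φ) :
    ∃ P ∈ translations Φ, ∃ Q ∈ translations Φ, P ^ 3 = 1 ∧ Q ^ 3 = 1 ∧ Commute P Q ∧
      (∀ i < 3, ∀ j < 3, ∀ p ∈ curve Φ, (P ^ i * Q ^ j) • p = p → i = 0 ∧ j = 0) ∧
      ∃ p₀ ∈ flexPoints Φ, ∀ p ∈ flexPoints Φ, ∃ i < 3, ∃ j < 3, (P ^ i * Q ^ j) • p₀ = p := by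
  obtain ⟨L, c, t, hL, ht⟩ := exists_hesseForm hΦ hs
  have hH := isHomogeneous_hesseForm t
  have hsH := hL.isSmooth hΦ hH hs
  obtain ⟨ω, hω⟩ := exists_isPrimitiveRoot_units
  have hω3 := hω.pow_eq_one
  have hω3' : (ω : ℂ) ^ 3 = 1 := by
    rw [← Units.val_pow_eq_pow_val, hω3, Units.val_one]
  let κ : ((Fin 3 → ℂ) ≃ₗ[ℂ] (Fin 3 → ℂ)) →* Equiv.Perm P2 :=
    projAut.comp (MulAut.conj L).toMonoidHom
  have hκ (M) : κ M = projAut (L * M * L⁻¹) := rfl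
  have hκ' (M q) : κ M (projAut L q) = projAut L (projAut M q) := by
    rw [hκ, map_mul, map_mul, map_inv, ← Equiv.Perm.mul_apply, inv_mul_cancel_right]
    rfl
  have hsim {M} (hM : IsSimilitude (hesseForm t) (hesseForm t) M 1) :
      IsSimilitude Φ Φ (L * M * L⁻¹) 1 := by
    have := (hL.mul hM).mul hL.inv
    rwa [mul_one, mul_inv_cancel₀ hL.1] at this
  have hX := hsim (isSimilitude_cyclicShift t)
  have hZ := hsim (isSimilitude_clockDiag t hω3)
  let P : autCurve (curve Φ) := ⟨κ cyclicShift, hX.projAut_mem hΦ⟩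
  let Q : autCurve (curve Φ) := ⟨κ (clockDiag ω), hZ.projAut_mem hΦ⟩
  have hPQ (i j : ℕ) (p : P2) :
      (P ^ i * Q ^ j) • p = κ (cyclicShift ^ i * clockDiag ω ^ j) p := by
    rw [map_mul, map_pow, map_pow]; rfl
  have hP3 : P ^ 3 = 1 := by
    refine Subtype.ext ?_
    change κ cyclicShift ^ 3 = 1
    rw [← map_pow, cyclicShift_pow_three, map_one]
  have hQ3 : Q ^ 3 = 1 := by
    refine Subtype.ext ?_
    change κ (clockDiag ω) ^ 3 = 1
    rw [← map_pow, ← map_pow, hω3, map_one, map_one]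
  have hcomm : Commute P Q := by
    refine Subtype.ext ?_
    change κ cyclicShift * κ (clockDiag ω) = κ (clockDiag ω) * κ cyclicShift
    -- The linear maps commute only up to the scalar `ω`.
    have h1 : projAut (cyclicShift * clockDiag ω) = projAut (clockDiag ω * cyclicShift) := by
      ext p
      induction p using Projectivization.ind with
      | _ v hv =>
        rw [projAut_mk, projAut_mk]
        refine (mk_eq_mk_iff' _ _ _ _ _).2 ⟨ω, ?_⟩
        ext i
        fin_cases i
        · simp [cyclicShift_apply, clockDiag_apply]
        · simp [cyclicShift_apply, clockDiag_apply]; ring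
        · simp [cyclicShift_apply, clockDiag_apply]; linear_combination v 0 * hω3'
    rw [← map_mul, ← map_mul, hκ, hκ]
    simp only [map_mul] at h1 ⊢
    rw [h1]
  have hcurve {p : P2} (hp : p ∈ curve Φ) : ∃ v, ∃ hv : v ≠ 0, p = projAut L (mk ℂ v hv) ∧
      MvPolynomial.eval v (hesseForm t) = 0 := by
    rw [← hL.image_curve hΦ hH] at hp
    obtain ⟨q, hq, rfl⟩ := hp
    induction q using Projectivization.ind with
    | _ v hv => exact ⟨v, hv, rfl, (mk_mem_curve_iff hH hv).1 hq⟩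
  have hone (j : ℕ) (p : P2) (hp : p ∈ curve Φ) : (P * Q ^ j) • p ≠ p := by
    intro h
    obtain ⟨v, hv, rfl, h0⟩ := hcurve hp
    rw [← pow_one P, hPQ, hκ', (projAut L).injective.eq_iff, projAut_mk_eq_iff, pow_one] at h
    obtain ⟨r, hr⟩ := h
    rw [← map_pow] at hr
    exact cyclicShift_fixed_free ht (by rw [← pow_mul, mul_comm, pow_mul, hω3, one_pow]) hv h0 r hr
  refine ⟨P, ⟨L * cyclicShift * L⁻¹, 1, rfl, hX, ?_⟩,
    Q, ⟨L * clockDiag ω * L⁻¹, 1, rfl, hZ, ?_⟩, hP3, hQ3, hcomm, ?_, ?_⟩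
  · rw [map_mul, map_mul, map_inv, mul_comm, inv_mul_cancel_left, det_cyclicShift]
  · rw [map_mul, map_mul, map_inv, mul_comm, inv_mul_cancel_left, det_clockDiag, hω3']
  · intro i hi j hj p hp h
    interval_cases i
    · refine ⟨rfl, ?_⟩
      obtain ⟨v, hv, rfl, h0⟩ := hcurve hp
      rw [hPQ, hκ', (projAut L).injective.eq_iff, projAut_mk_eq_iff, pow_zero, one_mul] at h
      obtain ⟨r, hr⟩ := h
      rw [← map_pow] at hr
      by_contra hj0
      exact clockDiag_fixed_free (by rw [← pow_mul, mul_comm, pow_mul, hω3, one_pow])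
        (hω.pow_ne_one_of_pos_of_lt hj0 hj) hv h0 r hr
    · exact absurd (by rwa [pow_one] at h) (hone j p hp)
    · refine absurd ?_ (hone (2 * j) p hp)
      -- A point fixed by `P² Qʲ` is fixed by its square `P Q²ʲ`, which is the case `i = 1`.
      have h2 : P * Q ^ (2 * j) = (P ^ 2 * Q ^ j) * (P ^ 2 * Q ^ j) := by
        have hc : Commute (Q ^ j) (P ^ 2) := (hcomm.pow_pow 2 j).symm
        rw [mul_assoc, ← mul_assoc (Q ^ j), hc.eq, mul_assoc, ← pow_add, ← mul_assoc, ← pow_add,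
          ← two_mul j, show 2 + 2 = 3 + 1 from rfl, pow_succ P 3, hP3, one_mul]
      rw [h2, mul_smul, h, h]
  · have he : (![0, 1, -1] : Fin 3 → ℂ) ≠ 0 := fun h => one_ne_zero (congrFun h 1)
    have hflex (v) (hv : v ≠ 0) : projAut L (mk ℂ v hv) ∈ flexPoints Φ ↔
        MvPolynomial.eval v (hesseForm t) = 0 ∧ v 0 * v 1 * v 2 = 0 := by
      rw [projAut_mk, mk_mem_flexPoints_iff hΦ, hL.isFlexVector_iff hΦ hH,
        isFlexVector_hesseForm_iff hsH hv]
    refine ⟨projAut L (mk ℂ _ he), (hflex _ _).2 ⟨by simp [eval_hesseForm]; ring, by simp⟩, ?_⟩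
    intro p hp
    obtain ⟨q, rfl⟩ := (projAut L).surjective p
    induction q using Projectivization.ind with
    | _ v hv =>
      obtain ⟨h0, h1⟩ := (hflex v hv).1 hp
      obtain ⟨i, hi, j, hj, hij⟩ := exists_cyclicShift_clockDiag_of_flex hω hv h0 h1
      exact ⟨i, hi, j, hj, by rw [hPQ, hκ', hij]⟩

end Hesse

theorem mem_curve_of_mem_flexPoints {p : P2} (hp : p ∈ flexPoints Φ) : p ∈ curve Φ := hp.1

/-- For commuting elements `P`, `Q` of order dividing three, the homomorphism
`(i, j) ↦ Pⁱ Qʲ`. -/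
def homOfCommute {G : Type*} [Group G] {P Q : G} (hP : P ^ 3 = 1) (hQ : Q ^ 3 = 1)
    (h : Commute P Q) : Multiplicative (ZMod 3 × ZMod 3) →* G where
  toFun x := P ^ x.toAdd.1.val * Q ^ x.toAdd.2.val
  map_one' := by simp
  map_mul' x y := by
    rw [toAdd_mul, Prod.fst_add, Prod.snd_add, ZMod.val_add, ZMod.val_add,
      ← pow_eq_pow_mod _ hP, ← pow_eq_pow_mod _ hQ, pow_add, pow_add]
    exact Commute.mul_mul_mul_comm (h.pow_pow _ _) _ _

/-- The translations form a group `(ℤ/3)²` acting freely on the curve and transitively on the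
flex points. -/
theorem exists_translation_mulEquiv (hΦ : Φ.IsHomogeneous 3) (hs : IsSmooth Φ) :
    ∃ (e : Multiplicative (ZMod 3 × ZMod 3) ≃* translations Φ),
      (∀ x, ∀ p ∈ curve Φ, (e x : autCurve (curve Φ)) • p = p → x = 1) ∧
      ∃ p₀ ∈ flexPoints Φ, ∀ p ∈ flexPoints Φ, ∃ x, (e x : autCurve (curve Φ)) • p₀ = p := by
  obtain ⟨P, hP, Q, hQ, hP3, hQ3, hPQ, hfree, p₀, hp₀, htrans⟩ :=
    exists_translation_generators hΦ hs
  let ψ : Multiplicative (ZMod 3 × ZMod 3) →* translations Φ :=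
    (homOfCommute hP3 hQ3 hPQ).codRestrict _ fun x =>
      mul_mem (pow_mem hP _) (pow_mem hQ _)
  have hψ (x) : (ψ x : autCurve (curve Φ)) = P ^ x.toAdd.1.val * Q ^ x.toAdd.2.val := rfl
  have hψfree (x) (p) (hp : p ∈ curve Φ) (h : (ψ x : autCurve (curve Φ)) • p = p) : x = 1 := by
    rw [hψ] at h
    obtain ⟨h1, h2⟩ := hfree _ (ZMod.val_lt _) _ (ZMod.val_lt _) p hp h
    rw [ZMod.val_eq_zero] at h1 h2
    exact Multiplicative.toAdd.injective (Prod.ext h1 h2)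
  have hψtrans (p) (hp : p ∈ flexPoints Φ) : ∃ x, (ψ x : autCurve (curve Φ)) • p₀ = p := by
    obtain ⟨i, hi, j, hj, h⟩ := htrans p hp
    refine ⟨.ofAdd (i, j), ?_⟩
    rw [hψ, ← h]
    simp [ZMod.val_natCast_of_lt hi, ZMod.val_natCast_of_lt hj]
  have hinj : Function.Injective ψ := by
    rw [injective_iff_map_eq_one]
    intro x hx
    exact hψfree x p₀ (mem_curve_of_mem_flexPoints hp₀) (by rw [hx]; exact one_smul _ _)
  have hsurj : Function.Surjective ψ := by
    -- The image of `p₀` under a translation `n` is also its image under some `ψ x`; the quotient is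
    -- a translation fixing a flex, hence trivial.
    intro n
    obtain ⟨x, hx⟩ := hψtrans _ (smul_mem_flexPoints hΦ hs n hp₀)
    refine ⟨x, Subtype.ext ?_⟩
    rw [← inv_mul_eq_one]
    refine eq_one_of_mem_translations_of_smul_eq hΦ hs (mul_mem (inv_mem (ψ x).2) n.2) hp₀ ?_
    rw [mul_smul, ← hx, inv_smul_smul]
  exact ⟨MulEquiv.ofBijective ψ ⟨hinj, hsurj⟩, hψfree, p₀, hp₀, hψtrans⟩

/-! ### Structure of the translation group and the split extension -/

section Translations

variable (hΦ : Φ.IsHomogeneous 3) (hs : IsSmooth Φ)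
include hΦ hs

theorem existsUnique_translation {p q : P2} (hp : p ∈ flexPoints Φ) (hq : q ∈ flexPoints Φ) :
    ∃! g : autCurve (curve Φ), g ∈ translations Φ ∧ g • p = q := by
  obtain ⟨e, -, p₀, -, htrans⟩ := exists_translation_mulEquiv hΦ hs
  obtain ⟨x, rfl⟩ := htrans p hp
  obtain ⟨y, rfl⟩ := htrans q hq
  have hn := mul_mem (e y).2 (inv_mem (e x).2)
  refine ⟨e y * (e x : autCurve (curve Φ))⁻¹, ⟨hn, by rw [mul_smul, inv_smul_smul]⟩, ?_⟩
  rintro g ⟨hg, hgp⟩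
  rw [← inv_mul_eq_one]
  refine eq_one_of_mem_translations_of_smul_eq hΦ hs (mul_mem (inv_mem hg) hn) hp ?_
  rw [mul_smul, mul_smul, inv_smul_smul, inv_smul_eq_iff, hgp]

/-- Matches the determinant condition with the fixed-point definition of `N`: freeness gives one
direction, the eigenvector on the cubic the other. -/
theorem mem_translations_iff (g : autCurve (curve Φ)) :
    g ∈ translations Φ ↔ g = 1 ∨ ∀ p ∈ curve Φ, g • p ≠ p := by
  constructor
  · intro hg
    obtain ⟨e, hfree, -⟩ := exists_translation_mulEquiv hΦ hs
    obtain ⟨x, hx⟩ := e.surjective ⟨g, hg⟩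
    have hx' : (e x : autCurve (curve Φ)) = g := congrArg Subtype.val hx
    by_cases h1 : x = 1
    · left
      rw [← hx', h1, map_one]; rfl
    · exact Or.inr fun p hp h => h1 (hfree x p hp (by rw [hx', h]))
  · rintro (rfl | h)
    · exact one_mem _
    · by_contra hg
      obtain ⟨p, hp, hgp⟩ := exists_fixed_point_of_notMem_translations hΦ hs hg
      exact h p hp hgp

theorem ncard_flexPoints : (flexPoints Φ).ncard = 9 := by
  obtain ⟨e, hfree, p₀, hp₀, htrans⟩ := exists_translation_mulEquiv hΦ hs
  have hrange : flexPoints Φ = Set.range fun x => (e x : autCurve (curve Φ)) • p₀ := by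
    ext p
    refine ⟨htrans p, ?_⟩
    rintro ⟨x, rfl⟩
    exact smul_mem_flexPoints hΦ hs _ hp₀
  have hinj : Function.Injective fun x => (e x : autCurve (curve Φ)) • p₀ := by
    intro x y hxy
    have hxy' : (e x : autCurve (curve Φ)) • p₀ = (e y : autCurve (curve Φ)) • p₀ := hxy
    rw [← inv_mul_eq_one]
    refine hfree _ p₀ (mem_curve_of_mem_flexPoints hp₀) ?_
    rw [map_mul, map_inv, Subgroup.coe_mul, Subgroup.coe_inv, mul_smul, ← hxy', inv_smul_smul]
  rw [hrange, ← Nat.card_coe_set_eq, Nat.card_range_of_injective hinj]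
  simp

theorem card_translations : Nat.card (translations Φ) = 9 := by
  obtain ⟨e, -⟩ := exists_translation_mulEquiv hΦ hs
  rw [← Nat.card_congr e.toEquiv]
  simp

theorem commute_translations {g h : autCurve (curve Φ)} (hg : g ∈ translations Φ)
    (hh : h ∈ translations Φ) : g * h = h * g := by
  obtain ⟨e, -⟩ := exists_translation_mulEquiv hΦ hs
  have := congrArg e (mul_comm (e.symm ⟨g, hg⟩) (e.symm ⟨h, hh⟩))
  rw [map_mul, map_mul, e.apply_symm_apply, e.apply_symm_apply] at this
  exact congrArg Subtype.val this

/-- Modulo a translation, an element commuting with all translations fixes one flex. By transitivity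
it then fixes all of them, so it is the identity. -/
theorem maximal_translations : Maximal
    (fun H : Subgroup (autCurve (curve Φ)) => ∀ g ∈ H, ∀ h ∈ H, g * h = h * g)
    (translations Φ) := by
  refine ⟨fun g hg h hh => commute_translations hΦ hs hg hh, fun H hH hle g hg => ?_⟩
  obtain ⟨-, -, p₀, hp₀, -⟩ := exists_translation_mulEquiv hΦ hs
  obtain ⟨n, ⟨hn, hnp⟩, -⟩ :=
    existsUnique_translation hΦ hs hp₀ (smul_mem_flexPoints hΦ hs g hp₀)
  suffices h : n⁻¹ * g = 1 by
    rw [inv_mul_eq_one] at h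
    exact h ▸ hn
  have hfix : (n⁻¹ * g) • p₀ = p₀ := by rw [mul_smul, ← hnp, inv_smul_smul]
  refine eq_one_of_forall_flexPoints hΦ hs fun p hp => ?_
  obtain ⟨m, ⟨hm, rfl⟩, -⟩ := existsUnique_translation hΦ hs hp₀ hp
  rw [← mul_smul, hH _ (mul_mem (inv_mem (hle hn)) hg) _ (hle hm), mul_smul, hfix]

theorem isComplement'_translations_stabilizer {p₀ : P2} (hp₀ : p₀ ∈ flexPoints Φ) :
    (translations Φ).IsComplement' (MulAction.stabilizer (autCurve (curve Φ)) p₀) := by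
  refine Subgroup.isComplement'_stabilizer p₀ (fun n hn => Subtype.ext ?_) fun g => ?_
  · exact eq_one_of_mem_translations_of_smul_eq hΦ hs n.2 hp₀ hn
  · obtain ⟨n, ⟨hn, hnp⟩, -⟩ :=
      existsUnique_translation hΦ hs (smul_mem_flexPoints hΦ hs g hp₀) hp₀
    exact ⟨⟨n, hn⟩, hnp⟩

/-- The quotient map sends `g` to the unique element of the stabilizer in its coset modulo
translations. -/
theorem exists_groupExtension {p₀ : P2} (hp₀ : p₀ ∈ flexPoints Φ) :
    ∃ (S : GroupExtension (translations Φ) (autCurve (curve Φ))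
        (MulAction.stabilizer (autCurve (curve Φ)) p₀)) (s : S.Splitting),
      S.inl = (translations Φ).subtype ∧
      ∀ g : MulAction.stabilizer (autCurve (curve Φ)) p₀, s g = (g : autCurve (curve Φ)) := by
  have := normal_translations hΦ hs
  let e := (isComplement'_translations_stabilizer hΦ hs hp₀).symm.QuotientMulEquiv
  let S : GroupExtension (translations Φ) (autCurve (curve Φ))
      (MulAction.stabilizer (autCurve (curve Φ)) p₀) :=
    { inl := (translations Φ).subtype
      rightHom := e.toMonoidHom.comp (QuotientGroup.mk' (translations Φ))
      inl_injective := Subtype.val_injective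
      range_inl_eq_ker_rightHom := by
        rw [Subgroup.range_subtype]
        ext g
        simp
      rightHom_surjective := e.surjective.comp (QuotientGroup.mk'_surjective _) }
  exact ⟨S, ⟨(MulAction.stabilizer (autCurve (curve Φ)) p₀).subtype,
    fun g => (e.symm_apply_eq (x := g)).1 rfl |>.symm⟩, rfl, fun g => rfl⟩

end Translations

/-! ### The invariant `J` and the order of the stabilizer -/

section JInvariant

open Projectivization

/-- A normal form of the curve that is taken at a flex point computes every `J`-value. -/
theorem eq_of_isJInvariant (hΦ : Φ.IsHomogeneous 3) (hs : IsSmooth Φ) {a b c : ℂ}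
    {L : (Fin 3 → ℂ) ≃ₗ[ℂ] (Fin 3 → ℂ)} (hL : IsSimilitude Φ (standardForm a b) L c)
    (hflex : projAut L (mk ℂ ![0, 1, 0] (fun h => one_ne_zero (congrFun h 1))) ∈ flexPoints Φ)
    {j : ℂ} (hj : IsJInvariant (curve Φ) j) : j = 4 * a ^ 3 / (4 * a ^ 3 + 27 * b ^ 2) := by
  obtain ⟨a', b', hd', ⟨g, hg, himg⟩, rfl⟩ := hj
  have hW' := isHomogeneous_standardForm a' b'
  have hey : (![0, 1, 0] : Fin 3 → ℂ) ≠ 0 := fun h => one_ne_zero (congrFun h 1)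
  obtain ⟨A, d, rfl, hA⟩ := exists_isSimilitude_of_image_eq hΦ hs hW'
    ⟨![1, 0, 0], by simp [eval_standardForm]⟩ hg himg
  have hq : projAut A⁻¹ (mk ℂ ![0, 1, 0] hey) ∈ flexPoints Φ := by
    rw [projAut_mk, mk_mem_flexPoints_iff hΦ, hA.inv.isFlexVector_iff hΦ hW']
    refine ⟨by simp [eval_standardForm], ⟨![0, 0, 1], by simp [dirDeriv_standardForm]⟩, ?_⟩
    intro w hw
    simp [dirDeriv_standardForm] at hw ⊢
    simp [hw]
  -- A translation carries the flex of one normal form to that of the other, so the change of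
  -- coordinates may be taken to fix `[0 : 1 : 0]`.
  obtain ⟨n, ⟨⟨N, k, hNn, hN, -⟩, hnp⟩, -⟩ := existsUnique_translation hΦ hs hflex hq
  have hnp' : projAut N (projAut L (mk ℂ ![0, 1, 0] hey)) = projAut A⁻¹ (mk ℂ ![0, 1, 0] hey) := by
    rw [hNn]; exact hnp
  have hr : projAut (A * N * L) (mk ℂ ![0, 1, 0] hey) = mk ℂ ![0, 1, 0] hey := by
    rw [map_mul, map_mul, Equiv.Perm.mul_apply, Equiv.Perm.mul_apply, hnp',
      ← Equiv.Perm.mul_apply, ← map_mul, mul_inv_cancel, map_one]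
    rfl
  obtain ⟨r, hr⟩ := (projAut_mk_eq_iff _ _).1 hr
  obtain ⟨s, u, -, hu, -, ha, hb, -⟩ := ((hA.mul hN).mul hL).standardForm_eq hr
  rw [ha, hb]
  -- Numerator and denominator both have weight 12 in `u`.
  rw [show 4 * (u ^ 4 * a) ^ 3 = u ^ 12 * (4 * a ^ 3) by ring,
    show 27 * (u ^ 6 * b) ^ 2 = u ^ 12 * (27 * b ^ 2) by ring, ← mul_add,
    mul_div_mul_left _ _ (pow_ne_zero 12 hu)]

theorem IsSimilitude.isJInvariant (hΦ : Φ.IsHomogeneous 3) {a b c : ℂ}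
    {L : (Fin 3 → ℂ) ≃ₗ[ℂ] (Fin 3 → ℂ)} (hL : IsSimilitude Φ (standardForm a b) L c)
    (hd : 4 * a ^ 3 + 27 * b ^ 2 ≠ 0) :
    IsJInvariant (curve Φ) (4 * a ^ 3 / (4 * a ^ 3 + 27 * b ^ 2)) :=
  ⟨a, b, hd, ⟨projAut L⁻¹, ⟨L⁻¹, rfl⟩,
    hL.inv.image_curve (isHomogeneous_standardForm a b) hΦ⟩, rfl⟩

theorem isJInvariant_iff (hΦ : Φ.IsHomogeneous 3) (hs : IsSmooth Φ) (j : ℂ) :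
    IsJInvariant (curve Φ) j ↔ j = jInvariant (curve Φ) := by
  obtain ⟨e, -, p₀, hp₀, -⟩ := exists_translation_mulEquiv hΦ hs
  obtain ⟨L, a, b, c, hL, hd, rfl⟩ := exists_normalForm_of_flex hΦ hs hp₀
  have hJ := hL.isJInvariant hΦ hd
  have hJ' : IsJInvariant (curve Φ) (jInvariant (curve Φ)) := Classical.epsilon_spec ⟨_, hJ⟩
  constructor
  · intro hj
    rw [eq_of_isJInvariant hΦ hs hL hp₀ hj, eq_of_isJInvariant hΦ hs hL hp₀ hJ']
  · rintro rfl
    exact hJ'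

/-- The conditions `u⁴ a = a` and `u⁶ b = b` become `u⁶ = 1` if `a = 0`, `u⁴ = 1` if `b = 0`, and
`u² = 1` otherwise; `J = 0` means `a = 0` and `J = 1` means `b = 0`. -/
theorem stabilizer_flex (hΦ : Φ.IsHomogeneous 3) (hs : IsSmooth Φ) {p₀ : P2}
    (hp₀ : p₀ ∈ flexPoints Φ) :
    IsCyclic (MulAction.stabilizer (autCurve (curve Φ)) p₀) ∧
      (jInvariant (curve Φ) = 0 →
        Nat.card (MulAction.stabilizer (autCurve (curve Φ)) p₀) = 6) ∧
      (jInvariant (curve Φ) = 1 →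
        Nat.card (MulAction.stabilizer (autCurve (curve Φ)) p₀) = 4) ∧
      (jInvariant (curve Φ) ≠ 0 → jInvariant (curve Φ) ≠ 1 →
        Nat.card (MulAction.stabilizer (autCurve (curve Φ)) p₀) = 2) := by
  obtain ⟨L, a, b, c, hL, hd, hp⟩ := exists_normalForm_of_flex hΦ hs hp₀
  have hj := (isJInvariant_iff hΦ hs _).1 (hL.isJInvariant hΦ hd)
  have h0 : jInvariant (curve Φ) = 0 ↔ a = 0 := by rw [← hj]; simp [hd]
  have h1 : jInvariant (curve Φ) = 1 ↔ b = 0 := by rw [← hj, div_eq_one_iff_eq hd]; simp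
  rw [h0, h1, Ne, Ne, h0, h1]
  have hstab := stabilizer_of_standardForm hΦ hs hL hp
  have hone (u : ℂˣ) (n : ℕ) : (u : ℂ) ^ n = 1 ↔ u ^ n = 1 := by
    rw [← Units.val_pow_eq_pow_val, Units.val_eq_one]
  by_cases ha : a = 0
  · have hb : b ≠ 0 := by rintro rfl; simp [ha] at hd
    have := hstab 6 fun u => by simp [ha, hb, hone]
    exact ⟨this.1, fun _ => this.2, fun h => absurd h hb, fun h => absurd ha h⟩
  · by_cases hb : b = 0
    · have := hstab 4 fun u => by simp [ha, hb, hone]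
      exact ⟨this.1, fun h => absurd h ha, fun _ => this.2, fun _ h => absurd hb h⟩
    · have := hstab 2 fun u => by
        simp only [mul_eq_right₀ ha, mul_eq_right₀ hb, hone]
        constructor
        · rintro ⟨h4, h6⟩
          rwa [show 6 = 4 + 2 from rfl, pow_add, h4, one_mul] at h6
        · intro h2
          exact ⟨by rw [show 4 = 2 * 2 from rfl, pow_mul, h2, one_pow],
            by rw [show 6 = 2 * 3 from rfl, pow_mul, h2, one_pow]⟩
      exact ⟨this.1, fun h => absurd h ha, fun h => absurd h hb, fun _ _ => this.2⟩

end JInvariant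

end PlaneCubic

/-! ### The main theorem -/

open PlaneCubic in
theorem mainTheorem2 (Φ : MvPolynomial (Fin 3) ℂ) (hΦ : Φ.IsHomogeneous 3)
    (hsmooth : IsSmooth Φ) :
    -- the number `J` is well defined by any standard normal form of the curve
    (∀ j : ℂ, IsJInvariant (curve Φ) j ↔ j = jInvariant (curve Φ)) ∧
    (flexPoints Φ).ncard = 9 ∧
    (∃ N : Subgroup (autCurve (curve Φ)),
      (∀ g : autCurve (curve Φ), g ∈ N ↔ (g = 1 ∨ ∀ p ∈ curve Φ, g • p ≠ p)) ∧
      N.Normal ∧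
      Nonempty (N ≃* Multiplicative (ZMod 3 × ZMod 3)) ∧
      Maximal (fun H : Subgroup (autCurve (curve Φ)) => ∀ g ∈ H, ∀ h ∈ H, g * h = h * g) N ∧
      -- simply transitive action on the flex points
      (∀ g ∈ N, ∀ p ∈ flexPoints Φ, g • p ∈ flexPoints Φ) ∧
      (∀ p ∈ flexPoints Φ, ∀ q ∈ flexPoints Φ, ∃! g : autCurve (curve Φ), g ∈ N ∧ g • p = q) ∧
      -- the exact sequence, split by the inclusion of the stabilizer of any flex point
      (∀ p₀ ∈ flexPoints Φ,
        ∃ (S : GroupExtension N (autCurve (curve Φ))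
            (MulAction.stabilizer (autCurve (curve Φ)) p₀)) (s : S.Splitting),
          S.inl = N.subtype ∧
          ∀ g : MulAction.stabilizer (autCurve (curve Φ)) p₀,
            s g = (g : autCurve (curve Φ)))) ∧
    (∀ p₀ ∈ flexPoints Φ,
      IsCyclic (MulAction.stabilizer (autCurve (curve Φ)) p₀) ∧
      (jInvariant (curve Φ) = 0 →
        Nat.card (MulAction.stabilizer (autCurve (curve Φ)) p₀) = 6) ∧
      (jInvariant (curve Φ) = 1 →
        Nat.card (MulAction.stabilizer (autCurve (curve Φ)) p₀) = 4) ∧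
      (jInvariant (curve Φ) ≠ 0 → jInvariant (curve Φ) ≠ 1 →
        Nat.card (MulAction.stabilizer (autCurve (curve Φ)) p₀) = 2)) ∧
    (jInvariant (curve Φ) = 0 → Nat.card (autCurve (curve Φ)) = 54) ∧
    (jInvariant (curve Φ) = 1 → Nat.card (autCurve (curve Φ)) = 36) ∧
    (jInvariant (curve Φ) ≠ 0 → jInvariant (curve Φ) ≠ 1 →
      Nat.card (autCurve (curve Φ)) = 18) := by
  have hcard {p₀} (hp₀ : p₀ ∈ flexPoints Φ) := (isComplement'_translations_stabilizer hΦ hsmooth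
    hp₀).card_mul_card
  rw [card_translations hΦ hsmooth] at hcard
  have hstab {p₀} (hp₀ : p₀ ∈ flexPoints Φ) := stabilizer_flex hΦ hsmooth hp₀
  obtain ⟨e, -, p₁, hp₁, -⟩ := exists_translation_mulEquiv hΦ hsmooth
  refine ⟨isJInvariant_iff hΦ hsmooth, ncard_flexPoints hΦ hsmooth,
    ⟨translations Φ, mem_translations_iff hΦ hsmooth, normal_translations hΦ hsmooth, ⟨e.symm⟩,
      maximal_translations hΦ hsmooth, fun g _ p hp => smul_mem_flexPoints hΦ hsmooth g hp,
      fun p hp q hq => existsUnique_translation hΦ hsmooth hp hq,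
      fun p₀ hp₀ => exists_groupExtension hΦ hsmooth hp₀⟩,
    fun p₀ hp₀ => hstab hp₀, fun h => ?_, fun h => ?_, fun h h' => ?_⟩
  · rw [← hcard hp₁, (hstab hp₁).2.1 h]
  · rw [← hcard hp₁, (hstab hp₁).2.2.1 h]
  · rw [← hcard hp₁, (hstab hp₁).2.2.2 h h']
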